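/- Let $N\ge 3$, let $\Omega\subset\mathbb{R}^N$ be a bounded open set with $C^1$ boundary, let $s\in(0,1)$, and let $p\in(N/2,\infty]$. Put $$c_{N,s}=\Big(\int_{\mathbb{R}^N}\frac{1-\cos\zeta_1}{|\zeta|^{N+2s}}\,d\zeta\Big)^{-1},\qquad \mathbb{X}(\Omega)=\{u\in H^1(\mathbb{R}^N):\ u=0 \text{ a.e. in } \mathbb{R}^N\setminus\Omega\}.$$ For $f\in L^p(\Omega)$, a weak solution of the homogeneous Dirichlet problem $$-\Delta u+(-\Delta)^s u=f \ \text{ in }\Omega,\qquad u=0\ \text{ in }\mathbb{R}^N\setminus\Omega,$$ is a function $u\in\mathbb{X}(\Omega)$ such that, for every $\varphi\in C_0^\infty(\Omega)$ (smooth functions with compact support in $\Omega$), $$\int_\Omega\langle\nabla u,\nabla\varphi\rangle\,dx+\frac{c_{N,s}}{2}\iint_{\mathbb{R}^N\times\mathbb{R}^N}\frac{(u(x)-u(y))(\varphi(x)-\varphi(y))}{|x-y|^{N+2s}}\,dx\,dy=\int_\Omega f\varphi\,dx.$$ Then there exists a constant $C>0$, depending only on $N$, $\Omega$, $s$ and $p$,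 such that, for every $f\in L^p(\Omega)$ and every weak solution $u_f\in\mathbb{X}(\Omega)$ of this problem, one has $u_f\in L^\infty(\mathbb{R}^N)$ and $$\|u_f\|_{L^\infty(\mathbb{R}^N)}\le C\,\|f\|_{L^p(\Omega)}.$$ -/

import Mathlib

open MeasureTheory Set
open scoped ContDiff ENNReal

noncomputable section

namespace MixedLaplacian

/-- A smooth real-valued test function whose (closed) support is a compact subset of `Ω`, that is,
an element of `C_0^∞(Ω, ℝ)`, extended by zero to the whole space. -/
structure IsTestFunction {N : ℕ} (Ω : Set (EuclideanSpace ℝ (Fin N)))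
    (φ : EuclideanSpace ℝ (Fin N) → ℝ) : Prop where
  contDiff : ContDiff ℝ ∞ φ
  hasCompactSupport : HasCompactSupport φ
  tsupport_subset : tsupport φ ⊆ Ω

/-- The open set `Ω` has `C¹` boundary: near each boundary point, `Ω` is, in a suitable orthonormal
coordinate system, the region strictly above the graph of a `C¹` function. Here the unit vector `e`
is the vertical direction, and `γ` is a function of the coordinates orthogonal to `e`. -/
def HasC1Boundary {N : ℕ} (Ω : Set (EuclideanSpace ℝ (Fin N))) : Prop :=
  ∀ x₀ ∈ frontier Ω, ∃ r : ℝ, 0 < r ∧ ∃ e : EuclideanSpace ℝ (Fin N), ‖e‖ = 1 ∧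
    ∃ γ : (Submodule.span ℝ {e})ᗮ → ℝ, ContDiff ℝ 1 γ ∧
      ∀ x ∈ Metric.ball x₀ r,
        x ∈ Ω ↔ γ ((Submodule.span ℝ {e})ᗮ.orthogonalProjectionOnto x) < inner ℝ x e

/-- `G` is a weak (distributional) gradient on `ℝ^N` of the function `u`: for every direction `v`
and every test function `φ`, one has `∫ u ∂_v φ = - ∫ ⟨G, v⟩ φ`. -/
def IsWeakGradient {N : ℕ} (u : EuclideanSpace ℝ (Fin N) → ℝ)
    (G : EuclideanSpace ℝ (Fin N) → EuclideanSpace ℝ (Fin N)) : Prop :=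
  ∀ φ : EuclideanSpace ℝ (Fin N) → ℝ, IsTestFunction univ φ →
    ∀ v : EuclideanSpace ℝ (Fin N),
      ∫ x, u x * fderiv ℝ φ x v = - ∫ x, inner ℝ (G x) v * φ x

/-- `u` belongs to `H¹(ℝ^N)`, with weak gradient `G` (which is unique up to null sets). -/
structure IsH1With {N : ℕ} (u : EuclideanSpace ℝ (Fin N) → ℝ)
    (G : EuclideanSpace ℝ (Fin N) → EuclideanSpace ℝ (Fin N)) : Prop where
  memLp : MemLp u 2 volume
  memLp_grad : MemLp G 2 volume
  isWeakGradient : IsWeakGradient u G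

/-- The space `𝕏(Ω)` of the functions in `H¹(ℝ^N)` that vanish a.e. outside `Ω`. -/
def MemX {N : ℕ} (Ω : Set (EuclideanSpace ℝ (Fin N)))
    (u : EuclideanSpace ℝ (Fin N) → ℝ) : Prop :=
  (∃ G, IsH1With u G) ∧ ∀ᵐ x ∂(volume : Measure (EuclideanSpace ℝ (Fin N))), x ∉ Ω → u x = 0

/-- The normalizing constant `c_{N,s} = (∫ (1 - cos ζ₁) / |ζ|^{N+2s} dζ)⁻¹` of the fractional
Laplacian `(-Δ)^s` on `ℝ^N`. -/
def fracConst (N : ℕ) [NeZero N] (s : ℝ) : ℝ :=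
  (∫ ζ : EuclideanSpace ℝ (Fin N), (1 - Real.cos (ζ 0)) / ‖ζ‖ ^ ((N : ℝ) + 2 * s))⁻¹

/-- The weak form of `-Δ u + (-Δ)^s u`, for a function `u` with weak gradient `G`, tested against
the smooth function `φ`. -/
def weakForm {N : ℕ} [NeZero N] (Ω : Set (EuclideanSpace ℝ (Fin N))) (s : ℝ)
    (u : EuclideanSpace ℝ (Fin N) → ℝ)
    (G : EuclideanSpace ℝ (Fin N) → EuclideanSpace ℝ (Fin N))
    (φ : EuclideanSpace ℝ (Fin N) → ℝ) : ℝ :=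
  (∫ x in Ω, inner ℝ (G x) (gradient φ x)) +
    fracConst N s / 2 *
      ∫ z : EuclideanSpace ℝ (Fin N) × EuclideanSpace ℝ (Fin N),
        (u z.1 - u z.2) * (φ z.1 - φ z.2) / ‖z.1 - z.2‖ ^ ((N : ℝ) + 2 * s)

/-- `u ∈ H¹(ℝ^N)` is a weak solution of the equation `-Δ u + (-Δ)^s u = f` in `Ω`. -/
def IsWeakSolutionEq {N : ℕ} [NeZero N] (Ω : Set (EuclideanSpace ℝ (Fin N))) (s : ℝ)
    (f u : EuclideanSpace ℝ (Fin N) → ℝ) : Prop :=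
  ∃ G : EuclideanSpace ℝ (Fin N) → EuclideanSpace ℝ (Fin N), IsH1With u G ∧
    ∀ φ : EuclideanSpace ℝ (Fin N) → ℝ, IsTestFunction Ω φ →
      weakForm Ω s u G φ = ∫ x in Ω, f x * φ x

/-- `u` is a weak solution of the homogeneous Dirichlet problem `-Δ u + (-Δ)^s u = f` in `Ω`,
`u = 0` in `ℝ^N ∖ Ω`. -/
def IsWeakSolution {N : ℕ} [NeZero N] (Ω : Set (EuclideanSpace ℝ (Fin N))) (s : ℝ)
    (f u : EuclideanSpace ℝ (Fin N) → ℝ) : Prop :=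
  IsWeakSolutionEq Ω s f u ∧ MemX Ω u

end MixedLaplacian

end

/-!
The proof is Stampacchia's truncation method, arranged so that the nonlinear test functions are only
ever applied to smooth functions.

Since `Ω` is bounded with `C¹` boundary, a solution `u` is a limit in `H¹` of test functions `φ n`
supported in `Ω` (`IsH1With.exists_isTestLimit`): a partition of unity cuts `u` into pieces, each of
which is pushed into `Ω` by the small translations in a fixed direction, and is then mollified. The
Gagliardo seminorm of order `s < 1` is controlled by the `H¹` norm
(`exists_eLpNorm_fracQuot_le`), so the convergence also holds in that seminorm.

Let `T` be a smooth function that goes from `0` below the level `k` to `1` above the level `h`, and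
let `ψ` be the primitive of `T'²` that vanishes below `k`. For a smooth `φ` the function `ψ ∘ φ` is
again a test function, the local part of the form is `∫ ⟨∇φ, ∇(ψ ∘ φ)⟩ = ∫ |∇(T ∘ φ)|²`, and the
nonlocal part is nonnegative because `ψ` is monotone. Testing the equation of `u` with `ψ ∘ φ n`
therefore bounds the energy of `T ∘ φ n` by `∫ f (ψ ∘ φ n)` up to a vanishing error
(`exists_energy_le`); no chain rule for weak gradients is needed. Sobolev's inequality for
`T ∘ φ n`, Fatou's lemma, and Hölder's inequality give, with `2*` the Sobolev exponent,
`|{u > h}| ^ (2 / 2*) ≤ C / (h - k) * ‖f‖_p * |{u > k}| ^ (1 - 1 / p)`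
(`exists_measure_superlevel_le`).

The condition `p > N / 2` says precisely that `1 - 1 / p > 2 / 2*`, so Stampacchia's iteration
(`exists_stampacchia_level`) makes the superlevel sets null above a fixed multiple of `‖f‖_p`. The
same bound applied to `-u` concludes.
-/

namespace MixedLaplacian

open Filter Topology
open scoped NNReal

/-! ### Mollification in `L²` -/

theorem eLpNorm_two_sq {α F : Type*} [MeasurableSpace α] [NormedAddCommGroup F] (f : α → F)
    (μ : Measure α) : eLpNorm f 2 μ ^ 2 = ∫⁻ x, ‖f x‖ₑ ^ 2 ∂μ := by
  have h := eLpNorm_nnreal_pow_eq_lintegral (f := f) (μ := μ) (p := 2) (by norm_num)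
  simpa using h

theorem eLpNorm_two_le_iff {α F : Type*} [MeasurableSpace α] [NormedAddCommGroup F] (f : α → F)
    (μ : Measure α) (c : ℝ≥0∞) : eLpNorm f 2 μ ≤ c ↔ ∫⁻ x, ‖f x‖ₑ ^ 2 ∂μ ≤ c ^ 2 := by
  rw [← eLpNorm_two_sq, ENNReal.pow_le_pow_left_iff two_ne_zero]

section Mollify

variable {E F : Type*} [NormedAddCommGroup E] [NormedSpace ℝ E] [FiniteDimensional ℝ E]
  [MeasurableSpace E] [BorelSpace E] [NormedAddCommGroup F]
  {μ : Measure E} [μ.IsAddHaarMeasure]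

/-- Translations act continuously on `L²`. -/
theorem exists_eLpNorm_translate_sub_le {f : E → F} (hf : MemLp f 2 μ) {ε : ℝ≥0∞} (hε : ε ≠ 0) :
    ∃ δ : ℝ, 0 < δ ∧ ∀ h : E, ‖h‖ < δ → eLpNorm (fun x => f (x - h) - f x) 2 μ ≤ ε := by
  have : Fact ((2 : ℝ≥0∞) ≠ ⊤) := ⟨by norm_num⟩
  have hc : Continuous fun h : E => DomAddAct.mk h +ᵥ hf.toLp f :=
    (continuous_id.vadd continuous_const).comp DomAddAct.mkHomeomorph.continuous
  have h0 : Tendsto (fun h : E => edist (DomAddAct.mk h +ᵥ hf.toLp f) (hf.toLp f)) (𝓝 0) (𝓝 0) := by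
    have := (hc.edist (continuous_const (y := hf.toLp f))).tendsto 0
    simpa using this
  obtain ⟨δ, hδ, hb⟩ := Metric.eventually_nhds_iff.1
    (h0.eventually (ge_mem_nhds (pos_iff_ne_zero.2 hε)))
  refine ⟨δ, hδ, fun h hh => ?_⟩
  have h1 := hb (y := -h) (by simpa using hh)
  rw [DomAddAct.mk_vadd_toLp, Lp.edist_toLp_toLp] at h1
  refine le_trans (le_of_eq ?_) h1
  congr 1
  ext x
  simp [sub_eq_add_neg, add_comm]

theorem sq_lintegral_mul_le {α : Type*} [MeasurableSpace α] {ν : Measure α} {ρ g : α → ℝ≥0∞}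
    (hρ : AEMeasurable ρ ν) (hg : AEMeasurable g ν) (h1 : ∫⁻ x, ρ x ∂ν = 1) :
    (∫⁻ x, ρ x * g x ∂ν) ^ 2 ≤ ∫⁻ x, ρ x * g x ^ 2 ∂ν := by
  have hr : AEMeasurable (fun x => ρ x ^ (1 / 2 : ℝ)) ν := hρ.pow_const _
  have key := ENNReal.lintegral_mul_le_Lp_mul_Lq ν (p := 2) (q := 2)
    (Real.HolderConjugate.two_two) hr (hr.mul hg)
  have e1 : ∀ x, ((fun x => ρ x ^ (1 / 2 : ℝ)) * ((fun x => ρ x ^ (1 / 2 : ℝ)) * g)) x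
      = ρ x * g x := fun x => by
    simp only [Pi.mul_apply]
    rw [← mul_assoc, ← ENNReal.rpow_add_of_nonneg _ _ (by norm_num) (by norm_num)]
    norm_num
  have e2 : ∀ x, (ρ x ^ (1 / 2 : ℝ)) ^ (2 : ℝ) = ρ x := fun x => by
    rw [← ENNReal.rpow_mul]; norm_num
  have e3 : ∀ x, (((fun x => ρ x ^ (1 / 2 : ℝ)) * g) x) ^ (2 : ℝ) = ρ x * g x ^ 2 := fun x => by
    simp only [Pi.mul_apply]
    rw [ENNReal.mul_rpow_of_nonneg _ _ (by norm_num), e2]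
    norm_num
  simp only [e1, e2, e3, h1] at key
  rw [ENNReal.one_rpow, one_mul] at key
  calc (∫⁻ x, ρ x * g x ∂ν) ^ 2 ≤ ((∫⁻ x, ρ x * g x ^ 2 ∂ν) ^ (1 / 2 : ℝ)) ^ 2 := by gcongr
    _ = _ := by
      rw [← ENNReal.rpow_natCast, ← ENNReal.rpow_mul]; norm_num

/-- Averaging the translates of `w` against a probability density moves `w` in `L²` at most as far
as the translations in the support of the density do. -/
theorem eLpNorm_convolution_sub_le [NormedSpace ℝ F] [CompleteSpace F] {ρ : E → ℝ} (hρc : Continuous ρ)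
    (hρs : HasCompactSupport ρ) (hρ0 : ∀ h, 0 ≤ ρ h) (hρ1 : ∫ h, ρ h ∂μ = 1) {w : E → F}
    (hw : MemLp w 2 μ) {ε : ℝ≥0∞}
    (hε : ∀ h ∈ Function.support ρ, eLpNorm (fun x => w (x - h) - w x) 2 μ ≤ ε) :
    eLpNorm (convolution ρ w (ContinuousLinearMap.lsmul ℝ ℝ) μ - w) 2 μ ≤ ε := by
  have hloc : LocallyIntegrable w μ := hw.locallyIntegrable (by norm_num)
  have hex := hρs.convolutionExists_left (ContinuousLinearMap.lsmul ℝ ℝ) hρc hloc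
  have hρi : Integrable ρ μ := hρc.integrable_of_hasCompactSupport hρs
  have hρl : ∫⁻ h, ‖ρ h‖ₑ ∂μ = 1 := by
    have := ofReal_integral_eq_lintegral_ofReal hρi (ae_of_all _ hρ0)
    rw [hρ1, ENNReal.ofReal_one] at this
    rw [this]
    exact lintegral_congr fun h => (Real.enorm_of_nonneg (hρ0 h))
  have hm : AEStronglyMeasurable (fun z : E × E => w (z.1 - z.2) - w z.1) (μ.prod μ) :=
    (hw.1.comp_quasiMeasurePreserving (quasiMeasurePreserving_sub μ μ)).sub hw.1.comp_fst
  rw [eLpNorm_two_le_iff]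
  have hpt : ∀ x, AEMeasurable (fun h => ‖w (x - h) - w x‖ₑ) μ →
      ‖(convolution ρ w (ContinuousLinearMap.lsmul ℝ ℝ) μ - w) x‖ₑ ^ 2
        ≤ ∫⁻ h, ‖ρ h‖ₑ * ‖w (x - h) - w x‖ₑ ^ 2 ∂μ := by
    intro x hx
    have e : (convolution ρ w (ContinuousLinearMap.lsmul ℝ ℝ) μ - w) x
        = ∫ h, ρ h • (w (x - h) - w x) ∂μ := by
      have h1 : Integrable (fun h => ρ h • w (x - h)) μ := hex x
      simp only [smul_sub]
      rw [integral_sub h1 (hρi.smul_const _), integral_smul_const, hρ1, one_smul]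
      rfl
    rw [e]
    calc _ ≤ (∫⁻ h, ‖ρ h • (w (x - h) - w x)‖ₑ ∂μ) ^ 2 := by
          gcongr; exact enorm_integral_le_lintegral_enorm _
      _ = (∫⁻ h, ‖ρ h‖ₑ * ‖w (x - h) - w x‖ₑ ∂μ) ^ 2 := by simp only [enorm_smul]
      _ ≤ _ := sq_lintegral_mul_le hρc.enorm.aemeasurable hx hρl
  have hm2 : AEMeasurable (fun z : E × E => ‖ρ z.2‖ₑ * ‖w (z.1 - z.2) - w z.1‖ₑ ^ 2)
      (μ.prod μ) :=
    ((hρc.comp continuous_snd).enorm.aemeasurable).mul (hm.enorm.pow_const 2)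
  calc _ ≤ ∫⁻ x, ∫⁻ h, ‖ρ h‖ₑ * ‖w (x - h) - w x‖ₑ ^ 2 ∂μ ∂μ := by
        refine lintegral_mono_ae ?_
        filter_upwards [hm.prodMk_left] with x hx
        exact hpt x hx.enorm
    _ = ∫⁻ h, ∫⁻ x, ‖ρ h‖ₑ * ‖w (x - h) - w x‖ₑ ^ 2 ∂μ ∂μ := lintegral_lintegral_swap hm2
    _ ≤ ∫⁻ h, ‖ρ h‖ₑ * ε ^ 2 ∂μ := by
        refine lintegral_mono fun h => ?_
        rw [lintegral_const_mul' _ _ (by simp)]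
        by_cases hh : ρ h = 0
        · simp [hh]
        · gcongr
          rw [← eLpNorm_two_le_iff]
          exact hε h hh
    _ = ε ^ 2 := by
        rw [lintegral_mul_const _ hρc.enorm.measurable, hρl, one_mul]

end Mollify

/-! ### Density of test functions in `𝕏(Ω)` -/

section Density

variable {N : ℕ}

local notation "𝔼" => EuclideanSpace ℝ (Fin N)

/-- The pair `(u, G)` lies in the `L² × L²` closure of the pairs `(φ, ∇φ)`, where `φ` runs through
the test functions in `Ω`; this says that `u` belongs to `H¹₀(Ω)` and has gradient `G`. -/
def IsTestLimit (Ω : Set 𝔼) (u : 𝔼 → ℝ) (G : 𝔼 → 𝔼) : Prop :=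
  ∀ ε : ℝ≥0∞, ε ≠ 0 → ∃ φ : 𝔼 → ℝ, IsTestFunction Ω φ ∧
    eLpNorm (φ - u) 2 volume ≤ ε ∧ eLpNorm (gradient φ - G) 2 volume ≤ ε

theorem inner_gradient (φ : 𝔼 → ℝ) (x v : 𝔼) : inner ℝ (gradient φ x) v = fderiv ℝ φ x v := by
  simp [gradient]

theorem norm_gradient (φ : 𝔼 → ℝ) (x : 𝔼) : ‖gradient φ x‖ = ‖fderiv ℝ φ x‖ := by
  simp [gradient]

theorem IsTestFunction.differentiable {Ω : Set 𝔼} {φ : 𝔼 → ℝ} (h : IsTestFunction Ω φ) :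
    Differentiable ℝ φ := h.contDiff.differentiable (by simp)

theorem continuous_gradient {φ : 𝔼 → ℝ} (h : ContDiff ℝ 1 φ) :
    Continuous (gradient φ) :=
  (InnerProductSpace.toDual ℝ 𝔼).symm.continuous.comp (h.continuous_fderiv (by simp))

theorem hasCompactSupport_gradient {φ : 𝔼 → ℝ} (h : HasCompactSupport φ) :
    HasCompactSupport (gradient φ) :=
  (h.fderiv (𝕜 := ℝ)).comp_left (g := (InnerProductSpace.toDual ℝ 𝔼).symm) (by simp)

theorem IsTestFunction.memLp {Ω : Set 𝔼} {φ : 𝔼 → ℝ} (h : IsTestFunction Ω φ) :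
    MemLp φ 2 volume := h.contDiff.continuous.memLp_of_hasCompactSupport h.hasCompactSupport

theorem IsTestFunction.memLp_gradient {Ω : Set 𝔼} {φ : 𝔼 → ℝ} (h : IsTestFunction Ω φ) :
    MemLp (gradient φ) 2 volume :=
  (continuous_gradient (h.contDiff.of_le (by simp))).memLp_of_hasCompactSupport
    (hasCompactSupport_gradient h.hasCompactSupport)

theorem IsTestFunction.add {Ω : Set 𝔼} {φ ψ : 𝔼 → ℝ} (h : IsTestFunction Ω φ)
    (h' : IsTestFunction Ω ψ) : IsTestFunction Ω (φ + ψ) where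
  contDiff := h.contDiff.add h'.contDiff
  hasCompactSupport := h.hasCompactSupport.add h'.hasCompactSupport
  tsupport_subset := (tsupport_add φ ψ).trans (union_subset h.tsupport_subset h'.tsupport_subset)

theorem IsTestFunction.comp_left {Ω : Set 𝔼} {φ : 𝔼 → ℝ} (h : IsTestFunction Ω φ) {F : ℝ → ℝ}
    (hF : ContDiff ℝ ∞ F) (h0 : F 0 = 0) : IsTestFunction Ω (F ∘ φ) where
  contDiff := hF.comp h.contDiff
  hasCompactSupport := h.hasCompactSupport.comp_left h0
  tsupport_subset := (tsupport_comp_subset h0 φ).trans h.tsupport_subset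

theorem gradient_comp {F : ℝ → ℝ} (hF : Differentiable ℝ F) {φ : 𝔼 → ℝ}
    (hφ : Differentiable ℝ φ) (x : 𝔼) : gradient (F ∘ φ) x = deriv F (φ x) • gradient φ x := by
  refine ext_inner_right ℝ fun v => ?_
  rw [inner_smul_left, inner_gradient, inner_gradient, fderiv_comp _ (hF _) (hφ _)]
  simp [mul_comm]

theorem gradient_add' {φ ψ : 𝔼 → ℝ} (hφ : Differentiable ℝ φ) (hψ : Differentiable ℝ ψ) :
    gradient (φ + ψ) = gradient φ + gradient ψ := by
  ext1 x
  refine ext_inner_right ℝ fun v => ?_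
  rw [inner_gradient, fderiv_add (hφ x) (hψ x), Pi.add_apply, inner_add_left, inner_gradient,
    inner_gradient]
  rfl

theorem IsTestLimit.add {Ω : Set 𝔼} {u u' : 𝔼 → ℝ} {G G' : 𝔼 → 𝔼}
    (hu : MemLp u 2 volume) (hG : MemLp G 2 volume) (hu' : MemLp u' 2 volume)
    (hG' : MemLp G' 2 volume) (h : IsTestLimit Ω u G)
    (h' : IsTestLimit Ω u' G') : IsTestLimit Ω (u + u') (G + G') := by
  intro ε hε
  have hε2 : ε / 2 ≠ 0 := by simpa using hε
  obtain ⟨φ, h1, h2, h3⟩ := h _ hε2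
  obtain ⟨ψ, k1, k2, k3⟩ := h' _ hε2
  refine ⟨φ + ψ, h1.add k1, ?_, ?_⟩
  · rw [add_sub_add_comm, ← ENNReal.add_halves ε]
    exact (eLpNorm_add_le (h1.memLp.1.sub hu.1) (k1.memLp.1.sub hu'.1) (by norm_num)).trans
      (add_le_add h2 k2)
  · rw [gradient_add' h1.differentiable k1.differentiable, add_sub_add_comm,
      ← ENNReal.add_halves ε]
    exact (eLpNorm_add_le (h1.memLp_gradient.1.sub hG.1) (k1.memLp_gradient.1.sub hG'.1)
      (by norm_num)).trans (add_le_add h3 k3)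

theorem isTestLimit_sum {Ω : Set 𝔼} {ι : Type*} (t : Finset ι) {u : ι → 𝔼 → ℝ} {G : ι → 𝔼 → 𝔼}
    (hu : ∀ i, MemLp (u i) 2 volume) (hG : ∀ i, MemLp (G i) 2 volume)
    (h : ∀ i, IsTestLimit Ω (u i) (G i)) : IsTestLimit Ω (∑ i ∈ t, u i) (∑ i ∈ t, G i) := by
  classical
  induction t using Finset.induction_on with
  | empty =>
    intro ε _
    have h0 : gradient (0 : 𝔼 → ℝ) = 0 := by
      ext1 x
      refine ext_inner_right ℝ fun v => ?_
      rw [inner_gradient]; simp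
    refine ⟨0, ⟨contDiff_const, HasCompactSupport.zero, by simp⟩, ?_, ?_⟩ <;> simp [h0]
  | insert i t hi ih =>
    rw [Finset.sum_insert hi, Finset.sum_insert hi]
    exact (h i).add (hu i) (hG i) (memLp_finsetSum' _ fun j _ => hu j)
      (memLp_finsetSum' _ fun j _ => hG j) ih

/-- Mollification commutes with the weak gradient. -/
theorem gradient_convolution {ρ : 𝔼 → ℝ} (hρ : ContDiff ℝ ∞ ρ) (hρs : HasCompactSupport ρ)
    {u : 𝔼 → ℝ} {G : 𝔼 → 𝔼} (h : IsH1With u G) :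
    gradient (convolution ρ u (ContinuousLinearMap.lsmul ℝ ℝ) volume)
      = convolution ρ G (ContinuousLinearMap.lsmul ℝ ℝ) volume := by
  have hul : LocallyIntegrable u volume := h.memLp.locallyIntegrable (by norm_num)
  have hGl : LocallyIntegrable G volume := h.memLp_grad.locallyIntegrable (by norm_num)
  ext1 x
  refine ext_inner_right ℝ fun v => ?_
  have hd := hρs.hasFDerivAt_convolution_left (ContinuousLinearMap.lsmul ℝ ℝ)
    (hρ.of_le (by simp)) hul x
  have hρs' : HasCompactSupport (fderiv ℝ ρ) := hρs.fderiv (𝕜 := ℝ)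
  have hex := hρs'.convolutionExists_left ((ContinuousLinearMap.lsmul ℝ ℝ).precompL 𝔼)
    (hρ.continuous_fderiv (by simp)) hul
  have hexG := hρs.convolutionExists_left (ContinuousLinearMap.lsmul ℝ ℝ)
    hρ.continuous hGl
  have hφ : IsTestFunction univ fun y => ρ (x - y) :=
    ⟨hρ.comp (contDiff_const.sub contDiff_id),
      hρs.comp_homeomorph (Homeomorph.subLeft x), subset_univ _⟩
  have hw := h.isWeakGradient _ hφ v
  have hfd : ∀ y, fderiv ℝ (fun y => ρ (x - y)) y v = - fderiv ℝ ρ (x - y) v := by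
    intro y
    have h1 : HasFDerivAt (fun y => ρ (x - y)) ((fderiv ℝ ρ (x - y)).comp (-ContinuousLinearMap.id ℝ 𝔼)) y :=
      (hρ.differentiable (by simp) (x - y)).hasFDerivAt.comp y
        ((hasFDerivAt_id y).const_sub x)
    rw [h1.fderiv]; simp
  rw [inner_gradient, hd.fderiv, convolution_eq_swap, convolution_eq_swap]
  have hi1 := (hex x).integrable_swap
  have hi2 := (hexG x).integrable_swap
  refine (ContinuousLinearMap.integral_apply hi1 v).trans ?_
  rw [real_inner_comm, ← integral_inner hi2]
  simp only [hfd, mul_neg, integral_neg, neg_inj] at hw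
  refine Eq.trans ?_ (hw.trans ?_)
  · refine integral_congr_ae (ae_of_all _ fun y => ?_)
    simp [ContinuousLinearMap.precompL, mul_comm]
  · refine integral_congr_ae (ae_of_all _ fun y => ?_)
    simp [inner_smul_right, mul_comm, real_inner_comm]

/-- A compactly supported `H¹` function whose support is pushed into `Ω` by the small translations
in a direction `e` is a limit of test functions in `Ω`: mollify it with a kernel concentrated near
the point `t • e`, on a scale much smaller than `t`. -/
theorem IsH1With.isTestLimit_of_push {Ω K : Set 𝔼} (hΩ : IsOpen Ω) (hK : IsCompact K) {w : 𝔼 → ℝ}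
    {W : 𝔼 → 𝔼} (h : IsH1With w W) (hw : ∀ x ∉ K, w x = 0) {e : 𝔼} {r : ℝ} (hr : 0 < r)
    (hpush : ∀ x ∈ K, ∀ t : ℝ, 0 < t → t < r → x + t • e ∈ Ω) : IsTestLimit Ω w W := by
  intro ε hε
  obtain ⟨δ₁, hδ₁, h₁⟩ := exists_eLpNorm_translate_sub_le h.memLp hε
  obtain ⟨δ₂, hδ₂, h₂⟩ := exists_eLpNorm_translate_sub_le h.memLp_grad hε
  set δ := min δ₁ δ₂ with hδ
  have hδ0 : 0 < δ := lt_min hδ₁ hδ₂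
  obtain ⟨t, ht0, htr, hte⟩ : ∃ t : ℝ, 0 < t ∧ t < r ∧ ‖t • e‖ < δ / 2 := by
    have h1 : ∀ᶠ t : ℝ in 𝓝[>] 0, ‖t • e‖ < δ / 2 := by
      have : Tendsto (fun t : ℝ => ‖t • e‖) (𝓝[>] 0) (𝓝 0) := by
        have h0 : Continuous fun t : ℝ => ‖t • e‖ := by fun_prop
        simpa using (h0.tendsto 0).mono_left nhdsWithin_le_nhds
      exact this.eventually_lt_const (by positivity)
    obtain ⟨t, h2, h3⟩ := (h1.and (Ioo_mem_nhdsGT hr)).exists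
    exact ⟨t, h3.1, h3.2, h2⟩
  have hKt : IsCompact ((fun x => x + t • e) '' K) := hK.image (by fun_prop)
  obtain ⟨η, hη0, hη⟩ := hKt.exists_cthickening_subset_open hΩ
    (by rintro _ ⟨x, hx, rfl⟩; exact hpush x hx t ht0 htr)
  set κ := min η (δ / 2) with hκ
  have hκ0 : 0 < κ := lt_min hη0 (by positivity)
  let b : ContDiffBump (t • e) := ⟨κ / 2, κ, by positivity, by linarith⟩
  set ρ : 𝔼 → ℝ := b.normed volume with hρ
  have hρc : ContDiff ℝ ∞ ρ := b.contDiff_normed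
  have hρs : HasCompactSupport ρ := b.hasCompactSupport_normed
  have hsupp : Function.support ρ = Metric.ball (t • e) κ := b.support_normed_eq
  have hsm : ∀ y ∈ Function.support ρ, ‖y‖ < δ := by
    intro y hy
    rw [hsupp, Metric.mem_ball, dist_eq_norm] at hy
    have h3 : ‖y‖ ≤ ‖y - t • e‖ + ‖t • e‖ := by simpa using norm_add_le (y - t • e) (t • e)
    have h4 : κ ≤ δ / 2 := min_le_right _ _
    linarith
  have hwl : LocallyIntegrable w volume := h.memLp.locallyIntegrable (by norm_num)
  set φ := convolution ρ w (ContinuousLinearMap.lsmul ℝ ℝ) volume with hφ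
  have hts : tsupport φ ⊆ Metric.cthickening η ((fun x => x + t • e) '' K) := by
    refine closure_minimal ?_ Metric.isClosed_cthickening
    refine (support_convolution_subset _).trans ?_
    rintro _ ⟨y, hy, x, hx, rfl⟩
    have hxK : x ∈ K := by by_contra hc; exact hx (hw x hc)
    rw [hsupp, Metric.mem_ball] at hy
    refine Metric.thickening_subset_cthickening _ _ (Metric.mem_thickening_iff.2
      ⟨x + t • e, ⟨x, hxK, rfl⟩, ?_⟩)
    have : dist (y + x) (x + t • e) = dist y (t • e) := by
      rw [add_comm y x, dist_add_left]
    simp only [this]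
    exact hy.trans_le (min_le_left _ _)
  refine ⟨φ, ⟨hρs.contDiff_convolution_left _ hρc hwl, ?_, hts.trans hη⟩, ?_, ?_⟩
  · exact HasCompactSupport.of_support_subset_isCompact hKt.cthickening
      (subset_closure.trans hts)
  · exact eLpNorm_convolution_sub_le hρc.continuous hρs b.nonneg_normed b.integral_normed h.memLp
      fun y hy => h₁ y ((hsm y hy).trans_le (min_le_left _ _))
  · rw [gradient_convolution hρc hρs h]
    exact eLpNorm_convolution_sub_le hρc.continuous hρs b.nonneg_normed b.integral_normed
      h.memLp_grad fun y hy => h₂ y ((hsm y hy).trans_le (min_le_right _ _))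

theorem memLp_of_norm_le_hasCompactSupport_mul {F H K : Type*} [NormedAddCommGroup F]
    [NormedAddCommGroup H] [NormedAddCommGroup K] {χ : 𝔼 → H} {f : 𝔼 → F} {g : 𝔼 → K}
    (hχ : Continuous χ) (hs : HasCompactSupport χ) (hf : MemLp f 2 volume)
    (hg : AEStronglyMeasurable g volume) (hle : ∀ x, ‖g x‖ ≤ ‖χ x‖ * ‖f x‖) :
    MemLp g 2 volume := by
  obtain ⟨C, hC⟩ := hs.exists_bound_of_continuous hχ
  refine hf.of_le_mul (c := C) hg (ae_of_all _ fun x => (hle x).trans ?_)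
  gcongr
  exact hC x

/-- The product rule for a weak gradient and a smooth cutoff. -/
theorem IsH1With.smooth_mul {u : 𝔼 → ℝ} {G : 𝔼 → 𝔼} (h : IsH1With u G) {χ : 𝔼 → ℝ}
    (hχ : IsTestFunction univ χ) :
    IsH1With (fun x => χ x * u x) (fun x => χ x • G x + u x • gradient χ x) := by
  have hgc : Continuous (gradient χ) := continuous_gradient (hχ.contDiff.of_le (by simp))
  have hχc := hχ.contDiff.continuous
  have m1 : MemLp (fun x => χ x * u x) 2 volume :=
    memLp_of_norm_le_hasCompactSupport_mul hχc hχ.hasCompactSupport h.memLp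
      (hχc.aestronglyMeasurable.mul h.memLp.1) fun x => (norm_mul _ _).le
  have m2 : MemLp (fun x => χ x • G x) 2 volume :=
    memLp_of_norm_le_hasCompactSupport_mul hχc hχ.hasCompactSupport h.memLp_grad
      (hχc.aestronglyMeasurable.smul h.memLp_grad.1) fun x => (norm_smul _ _).le
  have m3 : MemLp (fun x => u x • gradient χ x) 2 volume :=
    memLp_of_norm_le_hasCompactSupport_mul hgc (hasCompactSupport_gradient hχ.hasCompactSupport) h.memLp
      (h.memLp.1.smul hgc.aestronglyMeasurable) fun x => by rw [norm_smul, mul_comm]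
  refine ⟨m1, m2.add m3, fun φ hφ v => ?_⟩
  have hprod : IsTestFunction univ fun x => χ x * φ x :=
    ⟨hχ.contDiff.mul hφ.contDiff, hφ.hasCompactSupport.mul_left, subset_univ _⟩
  have hw := h.isWeakGradient _ hprod v
  have hfd : ∀ x, fderiv ℝ (fun x => χ x * φ x) x v
      = χ x * fderiv ℝ φ x v + φ x * fderiv ℝ χ x v := fun x => by
    rw [fderiv_fun_mul (hχ.differentiable x) (hφ.differentiable x)]; simp
  have hdφ : MemLp (fun x => fderiv ℝ φ x v) 2 volume :=
    ((hφ.contDiff.continuous_fderiv (by simp)).clm_apply continuous_const).memLp_of_hasCompactSupport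
      (hφ.hasCompactSupport.fderiv_apply (𝕜 := ℝ) v)
  have i1 : Integrable (fun x => χ x * u x * fderiv ℝ φ x v) volume := m1.integrable_mul hdφ
  have i3 : Integrable (fun x => inner ℝ (u x • gradient χ x) v * φ x) volume :=
    (m3.inner_const v).integrable_mul hφ.memLp
  have i2 : Integrable (fun x => inner ℝ (χ x • G x) v * φ x) volume :=
    (m2.inner_const v).integrable_mul hφ.memLp
  simp only [inner_add_left, add_mul]
  rw [integral_add i2 i3]
  have e1 : ∀ x, u x * (χ x * fderiv ℝ φ x v + φ x * fderiv ℝ χ x v)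
      = χ x * u x * fderiv ℝ φ x v + inner ℝ (u x • gradient χ x) v * φ x := fun x => by
    rw [inner_smul_left, inner_gradient]; simp; ring
  have e2 : ∀ x, inner ℝ (G x) v * (χ x * φ x) = inner ℝ (χ x • G x) v * φ x := fun x => by
    rw [inner_smul_left]; simp; ring
  simp only [hfd, e1, e2] at hw
  rw [integral_add i1 i3] at hw
  linarith

theorem IsH1With.neg {u : 𝔼 → ℝ} {G : 𝔼 → 𝔼} (h : IsH1With u G) : IsH1With (-u) (-G) := by
  refine ⟨h.memLp.neg, h.memLp_grad.neg, fun φ hφ v => ?_⟩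
  have := h.isWeakGradient φ hφ v
  simp [integral_neg, this]

/-- Near each point of the closure of a domain with `C¹` boundary, all small translations in some
direction push the closure into the domain. -/
theorem exists_push_of_mem_closure {Ω : Set 𝔼} (hΩ : IsOpen Ω) (hC : HasC1Boundary Ω) {x₀ : 𝔼}
    (hx₀ : x₀ ∈ closure Ω) : ∃ r : ℝ, 0 < r ∧ ∃ e : 𝔼,
      ∀ x ∈ closure Ω ∩ Metric.closedBall x₀ r, ∀ t : ℝ, 0 < t → t < r → x + t • e ∈ Ω := by
  by_cases hx : x₀ ∈ Ω
  · obtain ⟨r, hr, hb⟩ := Metric.isOpen_iff.1 hΩ x₀ hx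
    refine ⟨r / 2, by positivity, 0, fun x hx t _ _ => ?_⟩
    rw [smul_zero, add_zero]
    exact hb (Metric.closedBall_subset_ball (by linarith) hx.2)
  · obtain ⟨r, hr, e, he, γ, hγ, hb⟩ := hC x₀ ⟨hx₀, by rwa [hΩ.interior_eq]⟩
    refine ⟨r / 3, by positivity, e, fun x hx t ht0 htr => ?_⟩
    have hxb : x ∈ Metric.ball x₀ r := Metric.closedBall_subset_ball (by linarith) hx.2
    set P := (Submodule.span ℝ {e})ᗮ.orthogonalProjectionOnto with hP
    have hle : γ (P x) ≤ inner ℝ x e := by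
      have hcl : x ∈ closure (Metric.ball x₀ r ∩ Ω) :=
        Metric.isOpen_ball.inter_closure ⟨hxb, hx.1⟩
      have hclosed : IsClosed {y : 𝔼 | γ (P y) ≤ inner ℝ y e} :=
        isClosed_le (hγ.continuous.comp P.continuous) (by fun_prop)
      exact closure_minimal (fun y hy => ((hb y hy.1).1 hy.2).le) hclosed hcl
    have hPe : P e = 0 :=
      Submodule.orthogonalProjectionOnto_orthogonal_apply_eq_zero
        (Submodule.mem_span_singleton_self e)
    refine (hb _ ?_).2 ?_
    · have h1 : dist x x₀ ≤ r / 3 := hx.2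
      rw [Metric.mem_ball, dist_eq_norm]
      calc ‖x + t • e - x₀‖ = ‖(x - x₀) + t • e‖ := by congr 1; abel
        _ ≤ ‖x - x₀‖ + ‖t • e‖ := norm_add_le _ _
        _ < r := by
          rw [norm_smul, he, mul_one, Real.norm_of_nonneg ht0.le, ← dist_eq_norm]; linarith
    · rw [map_add, map_smul, hPe, smul_zero, add_zero, inner_add_left, inner_smul_left,
        real_inner_self_eq_norm_sq, he]
      simp
      linarith

theorem IsTestLimit.congr_ae {Ω : Set 𝔼} {u u' : 𝔼 → ℝ} {G : 𝔼 → 𝔼} (h : IsTestLimit Ω u G)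
    (hu : u =ᵐ[volume] u') : IsTestLimit Ω u' G := by
  intro ε hε
  obtain ⟨φ, h1, h2, h3⟩ := h ε hε
  refine ⟨φ, h1, ?_, h3⟩
  rwa [eLpNorm_congr_ae (g := φ - u)]
  exact (EventuallyEq.rfl (f := φ)).sub hu.symm

/-- In a bounded domain with `C¹` boundary, the functions of `𝕏(Ω)` are limits of test functions
in `Ω` (the gradient of the limit is only identified inside `Ω`, which is all that matters). -/
theorem IsH1With.exists_isTestLimit {Ω : Set 𝔼} (hΩ : IsOpen Ω) (hb : Bornology.IsBounded Ω)
    (hC : HasC1Boundary Ω) {u : 𝔼 → ℝ} {G : 𝔼 → 𝔼} (h : IsH1With u G)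
    (h0 : ∀ᵐ x ∂(volume : Measure 𝔼), x ∉ Ω → u x = 0) :
    ∃ G' : 𝔼 → 𝔼, MemLp G' 2 volume ∧ (∀ x ∈ Ω, G' x = G x) ∧ IsTestLimit Ω u G' := by
  classical
  have hK : IsCompact (closure Ω) := hb.isCompact_closure
  -- a representative that vanishes everywhere outside `Ω`
  set w : 𝔼 → ℝ := Ω.indicator u with hw
  have hwu : w =ᵐ[volume] u := by
    filter_upwards [h0] with x hx
    by_cases hxΩ : x ∈ Ω
    · simp [hw, hxΩ]
    · simp [hw, hxΩ, hx hxΩ]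
  have hH : IsH1With w G := by
    refine ⟨(memLp_congr_ae hwu).2 h.memLp, h.memLp_grad, fun φ hφ v => ?_⟩
    rw [← h.isWeakGradient φ hφ v]
    refine integral_congr_ae ?_
    filter_upwards [hwu] with x hx
    rw [hx]
  choose! r hr e hpush using fun x (hx : x ∈ closure Ω) => exists_push_of_mem_closure hΩ hC hx
  obtain ⟨t, htK, htc⟩ := hK.elim_nhds_subcover (fun x => Metric.ball x (r x))
    fun x hx => Metric.ball_mem_nhds x (hr x hx)
  obtain ⟨χ, hχ⟩ := SmoothPartitionOfUnity.exists_isSubordinate (ι := t)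
    (modelWithCornersSelf ℝ 𝔼) (isClosed_closure (s := Ω))
    (fun i => Metric.ball (i : 𝔼) (r i)) (fun i => Metric.isOpen_ball)
    (by simpa [iUnion_subtype] using htc)
  have hcpt : ∀ i, HasCompactSupport (χ i) := fun i =>
    HasCompactSupport.of_support_subset_isCompact (isCompact_closedBall (i : 𝔼) (r i))
      ((subset_tsupport _).trans ((hχ i).trans Metric.ball_subset_closedBall))
  have htest : ∀ i, IsTestFunction univ (χ i) := fun i =>
    ⟨(χ i).contMDiff.contDiff, hcpt i, subset_univ _⟩
  have hsum : ∀ x ∈ closure Ω, ∑ i, χ i x = 1 := fun x hx => by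
    rw [← finsum_eq_sum_of_fintype]; exact χ.sum_eq_one hx
  have hHi := fun i => hH.smooth_mul (htest i)
  have hlim := isTestLimit_sum (Ω := Ω) Finset.univ (fun i => (hHi i).memLp)
    (fun i => (hHi i).memLp_grad) fun i => by
      have hi : (i : 𝔼) ∈ closure Ω := htK _ i.2
      refine (hHi i).isTestLimit_of_push hΩ (hK.inter_right (Metric.isClosed_closedBall
        (x := (i : 𝔼)) (ε := r i))) (fun x hx => ?_) (hr _ hi) (hpush _ hi)
      by_contra hne
      refine hx ⟨?_, ?_⟩
      · by_contra hc
        exact hne (by rw [hw, indicator_of_notMem fun hΩx => hc (subset_closure hΩx), mul_zero])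
      · have : x ∈ Function.support (χ i) := fun hc => hne (by simp [hc])
        exact Metric.ball_subset_closedBall (hχ i (subset_tsupport _ this))
  refine ⟨_, memLp_finsetSum' _ fun i _ => (hHi i).memLp_grad, fun x hx => ?_,
    hlim.congr_ae (EventuallyEq.trans (EventuallyEq.of_eq ?_) hwu)⟩
  · have hg : ∑ i, gradient (χ i) x = 0 := by
      refine ext_inner_right ℝ fun v => ?_
      have h1 : (fun y => ∑ i, χ i y) =ᶠ[𝓝 x] fun _ => (1 : ℝ) := by
        filter_upwards [hΩ.mem_nhds hx] with y hy using hsum y (subset_closure hy)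
      have h2 := h1.fderiv_eq (𝕜 := ℝ)
      rw [fderiv_fun_sum fun i _ => (htest i).differentiable x] at h2
      simp only [sum_inner, inner_gradient, inner_zero_left]
      simpa using congrArg (fun L : 𝔼 →L[ℝ] ℝ => L v) h2
    simp only [Finset.sum_apply, Finset.sum_add_distrib, ← Finset.sum_smul, ← Finset.smul_sum,
      hsum x (subset_closure hx), hg, one_smul, smul_zero, add_zero]
  · ext1 x
    simp only [Finset.sum_apply, ← Finset.sum_mul]
    by_cases hx : x ∈ Ω
    · rw [hsum x (subset_closure hx), one_mul]
    · simp [hw, hx]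

end Density

/-! ### The Gagliardo seminorm on `H¹` -/

section Gagliardo

variable {N : ℕ}

local notation "𝔼" => EuclideanSpace ℝ (Fin N)

/-- The difference quotient whose `L²` norm on `ℝ^N × ℝ^N` is the Gagliardo seminorm of order `s`. -/
noncomputable def fracQuot (s : ℝ) (w : 𝔼 → ℝ) (z : 𝔼 × 𝔼) : ℝ :=
  (w z.1 - w z.2) / ‖z.1 - z.2‖ ^ (((N : ℝ) + 2 * s) / 2)

theorem fracQuot_mul_fracQuot {s : ℝ} (hs : 0 < s) (u φ : 𝔼 → ℝ) (z : 𝔼 × 𝔼) :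
    (u z.1 - u z.2) * (φ z.1 - φ z.2) / ‖z.1 - z.2‖ ^ ((N : ℝ) + 2 * s)
      = fracQuot s u z * fracQuot s φ z := by
  have h : ‖z.1 - z.2‖ ^ ((N : ℝ) + 2 * s)
      = ‖z.1 - z.2‖ ^ (((N : ℝ) + 2 * s) / 2) * ‖z.1 - z.2‖ ^ (((N : ℝ) + 2 * s) / 2) := by
    rw [← Real.rpow_add' (norm_nonneg _) (by positivity), add_halves]
  rw [h, fracQuot, fracQuot, div_mul_div_comm]

theorem fracQuot_sub (s : ℝ) (u v : 𝔼 → ℝ) : fracQuot s (u - v) = fracQuot s u - fracQuot s v := by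
  ext z
  simp only [fracQuot, Pi.sub_apply]
  ring

theorem aestronglyMeasurable_fracQuot (s : ℝ) {w : 𝔼 → ℝ}
    (hw : AEStronglyMeasurable w volume) : AEStronglyMeasurable (fracQuot s w) volume := by
  have hm : Measurable fun z : 𝔼 × 𝔼 => (‖z.1 - z.2‖ ^ (((N : ℝ) + 2 * s) / 2))⁻¹ :=
    ((measurable_fst.sub measurable_snd).norm.pow_const _).inv
  exact (hw.comp_fst.sub hw.comp_snd).mul hm.aestronglyMeasurable

/-- Translating by `h` moves a test function in `L²` by at most `‖h‖ ‖∇φ‖₂`. -/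
theorem IsTestFunction.lintegral_translate_sub_le {φ : 𝔼 → ℝ} (hφ : IsTestFunction univ φ)
    (h : 𝔼) : ∫⁻ x, ‖φ (h + x) - φ x‖ₑ ^ 2 ≤ ‖h‖ₑ ^ 2 * ∫⁻ x, ‖gradient φ x‖ₑ ^ 2 := by
  have hfc : Continuous (fderiv ℝ φ) := hφ.contDiff.continuous_fderiv (by simp)
  have hgc : Continuous (gradient φ) := continuous_gradient (hφ.contDiff.of_le (by simp))
  have hpt : ∀ x, ‖φ (h + x) - φ x‖ₑ ^ 2
      ≤ ‖h‖ₑ ^ 2 * ∫⁻ t in Ioc (0 : ℝ) 1, ‖gradient φ (x + t • h)‖ₑ ^ 2 := by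
    intro x
    have hd : ∀ t : ℝ, HasDerivAt (fun t : ℝ => φ (x + t • h)) (fderiv ℝ φ (x + t • h) h) t := by
      intro t
      have h1 : HasDerivAt (fun t : ℝ => x + t • h) h t := by
        simpa using ((hasDerivAt_id t).smul_const h).const_add x
      exact (hφ.differentiable (x + t • h)).hasFDerivAt.comp_hasDerivAt t h1
    have hc : Continuous fun t : ℝ => fderiv ℝ φ (x + t • h) h :=
      (hfc.comp (by fun_prop)).clm_apply continuous_const
    have e : φ (h + x) - φ x = ∫ t in Ioc (0 : ℝ) 1, fderiv ℝ φ (x + t • h) h := by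
      rw [← intervalIntegral.integral_of_le zero_le_one,
        intervalIntegral.integral_eq_sub_of_hasDerivAt (fun t _ => hd t)
          (hc.intervalIntegrable _ _)]
      simp [add_comm]
    have hm : Measurable fun t : ℝ => ‖gradient φ (x + t • h)‖ₑ :=
      (hgc.comp (by fun_prop)).enorm.measurable
    have hle : ‖φ (h + x) - φ x‖ₑ
        ≤ ‖h‖ₑ * ∫⁻ t in Ioc (0 : ℝ) 1, 1 * ‖gradient φ (x + t • h)‖ₑ := by
      rw [e, ← lintegral_const_mul _ (by simpa using hm)]
      refine (enorm_integral_le_lintegral_enorm _).trans (lintegral_mono fun t => ?_)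
      have h2 : ‖fderiv ℝ φ (x + t • h) h‖ ≤ ‖h‖ * ‖gradient φ (x + t • h)‖ := by
        rw [norm_gradient, mul_comm]
        exact ContinuousLinearMap.le_opNorm _ _
      rw [one_mul, ← ofReal_norm, ← ofReal_norm, ← ofReal_norm,
        ← ENNReal.ofReal_mul (norm_nonneg _)]
      exact ENNReal.ofReal_le_ofReal h2
    calc _ ≤ (‖h‖ₑ * ∫⁻ t in Ioc (0 : ℝ) 1, 1 * ‖gradient φ (x + t • h)‖ₑ) ^ 2 := by gcongr
      _ = ‖h‖ₑ ^ 2 * (∫⁻ t in Ioc (0 : ℝ) 1, 1 * ‖gradient φ (x + t • h)‖ₑ) ^ 2 := mul_pow _ _ _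
      _ ≤ ‖h‖ₑ ^ 2 * ∫⁻ t in Ioc (0 : ℝ) 1, 1 * ‖gradient φ (x + t • h)‖ₑ ^ 2 := by
          gcongr
          exact sq_lintegral_mul_le (ρ := fun _ => 1) aemeasurable_const hm.aemeasurable (by simp)
      _ = _ := by simp only [one_mul]
  have hm2 : Measurable fun z : 𝔼 × ℝ => ‖gradient φ (z.1 + z.2 • h)‖ₑ ^ 2 :=
    ((hgc.comp (by fun_prop)).enorm.measurable).pow_const 2
  calc _ ≤ ∫⁻ x, ‖h‖ₑ ^ 2 * ∫⁻ t in Ioc (0 : ℝ) 1, ‖gradient φ (x + t • h)‖ₑ ^ 2 :=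
        lintegral_mono hpt
    _ = ‖h‖ₑ ^ 2 * ∫⁻ x, ∫⁻ t in Ioc (0 : ℝ) 1, ‖gradient φ (x + t • h)‖ₑ ^ 2 :=
        lintegral_const_mul' _ _ (by simp)
    _ = ‖h‖ₑ ^ 2 * ∫⁻ t in Ioc (0 : ℝ) 1, ∫⁻ x, ‖gradient φ (x + t • h)‖ₑ ^ 2 := by
        rw [lintegral_lintegral_swap hm2.aemeasurable]
    _ = _ := by
        congr 1
        have : ∀ t : ℝ, ∫⁻ x, ‖gradient φ (x + t • h)‖ₑ ^ 2 = ∫⁻ x, ‖gradient φ x‖ₑ ^ 2 :=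
          fun t => lintegral_add_right_eq_self (fun x => ‖gradient φ x‖ₑ ^ 2) (t • h)
        simp [this]

/-- The singular kernel, weighted by the best bound on a squared difference of an `H¹` function,
is integrable. This is where `0 < s < 1` is needed. -/
theorem integrable_min_mul_rpow_norm (hN : 0 < N) {s : ℝ} (hs : s ∈ Ioo (0 : ℝ) 1) :
    Integrable (fun h : 𝔼 => min 1 (‖h‖ ^ 2) * ‖h‖ ^ (-((N : ℝ) + 2 * s))) volume := by
  have : Nonempty (Fin N) := ⟨⟨0, hN⟩⟩
  rw [integrable_fun_norm_addHaar (volume : Measure 𝔼)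
    (f := fun y : ℝ => min 1 (y ^ 2) * y ^ (-((N : ℝ) + 2 * s)))]
  rw [finrank_euclideanSpace_fin, ← Ioc_union_Ioi_eq_Ioi (zero_le_one' ℝ)]
  have hpow : ∀ y : ℝ, 0 < y → y ^ (N - 1) = y ^ ((N : ℝ) - 1) := fun y hy => by
    rw [← Real.rpow_natCast, Nat.cast_sub hN, Nat.cast_one]
  refine IntegrableOn.union ?_ ?_
  · have h1 : IntegrableOn (fun y : ℝ => y ^ (1 - 2 * s)) (Ioc 0 1) :=
      (intervalIntegrable_iff_integrableOn_Ioc_of_le zero_le_one).1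
        (intervalIntegral.intervalIntegrable_rpow' (by linarith [hs.2]))
    refine h1.congr_fun (fun y hy => ?_) measurableSet_Ioc
    have hy2 : y ^ 2 ≤ 1 := pow_le_one₀ hy.1.le hy.2
    simp only [smul_eq_mul]
    rw [min_eq_right hy2, hpow y hy.1, ← Real.rpow_natCast y 2, ← Real.rpow_add hy.1,
      ← Real.rpow_add hy.1]
    congr 1
    push_cast
    ring
  · have h1 : IntegrableOn (fun y : ℝ => y ^ (-1 - 2 * s)) (Ioi 1) :=
      integrableOn_Ioi_rpow_of_lt (by linarith [hs.1]) one_pos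
    refine h1.congr_fun (fun y hy => ?_) measurableSet_Ioi
    have hy0 : (0 : ℝ) < y := one_pos.trans hy
    have hy2 : 1 ≤ y ^ 2 := one_le_pow₀ (le_of_lt hy)
    simp only [smul_eq_mul]
    rw [min_eq_left hy2, hpow y hy0, one_mul, ← Real.rpow_add hy0]
    congr 1
    ring

/-- The Gagliardo seminorm of order `s < 1` is dominated by the `H¹` norm. -/
theorem exists_eLpNorm_fracQuot_le (hN : 0 < N) {s : ℝ} (hs : s ∈ Ioo (0 : ℝ) 1) :
    ∃ C : ℝ≥0∞, C ≠ ⊤ ∧ ∀ φ : 𝔼 → ℝ, IsTestFunction univ φ →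
      eLpNorm (fracQuot s φ) 2 volume
        ≤ C * (eLpNorm φ 2 volume + eLpNorm (gradient φ) 2 volume) := by
  set k : 𝔼 → ℝ≥0∞ := fun h => ENNReal.ofReal (‖h‖ ^ (-((N : ℝ) + 2 * s))) with hk
  set J : ℝ≥0∞ := ∫⁻ h : 𝔼, ENNReal.ofReal (min 1 (‖h‖ ^ 2) * ‖h‖ ^ (-((N : ℝ) + 2 * s))) with hJ
  have hJt : J ≠ ⊤ := (integrable_min_mul_rpow_norm hN hs).lintegral_lt_top.ne
  refine ⟨(4 * J) ^ (1 / 2 : ℝ), ENNReal.rpow_ne_top_of_nonneg (by norm_num)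
    (ENNReal.mul_ne_top (by norm_num) hJt), fun φ hφ => ?_⟩
  set a := eLpNorm φ 2 volume with ha
  set b := eLpNorm (gradient φ) 2 volume with hb
  rw [eLpNorm_two_le_iff]
  have hkm : Measurable k := by fun_prop
  have hker : ∀ x y : 𝔼, ‖fracQuot s φ (x + y, y)‖ₑ ^ 2 = k x * ‖φ (x + y) - φ y‖ₑ ^ 2 := by
    intro x y
    have hsq : (‖x‖ ^ (((N : ℝ) + 2 * s) / 2)) ^ 2 = ‖x‖ ^ ((N : ℝ) + 2 * s) := by
      rw [← Real.rpow_natCast, ← Real.rpow_mul (norm_nonneg _)]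
      congr 1; push_cast; ring
    simp only [fracQuot, add_sub_cancel_right, hk]
    rw [← enorm_pow, ← enorm_pow, div_pow, hsq, Real.rpow_neg (norm_nonneg _), div_eq_inv_mul,
      enorm_mul, Real.enorm_of_nonneg (by positivity)]
  have hdiff : ∀ x : 𝔼, ∫⁻ y, ‖φ (x + y) - φ y‖ₑ ^ 2
      ≤ ENNReal.ofReal (min 1 (‖x‖ ^ 2)) * (4 * (a + b) ^ 2) := by
    intro x
    rcases le_total 1 (‖x‖ ^ 2) with hx | hx
    · rw [min_eq_left hx, ENNReal.ofReal_one, one_mul]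
      have h1 : eLpNorm (fun y => φ (x + y)) 2 volume = a :=
        eLpNorm_comp_measurePreserving hφ.memLp.1 (measurePreserving_add_left volume x)
      have h2 : eLpNorm (fun y => φ (x + y) - φ y) 2 volume ≤ a + a := by
        have := eLpNorm_sub_le (μ := volume) (f := fun y => φ (x + y)) (g := φ) (p := 2)
          (hφ.contDiff.continuous.comp (by fun_prop)).aestronglyMeasurable hφ.memLp.1 (by norm_num)
        rwa [h1] at this
      rw [← eLpNorm_two_sq (fun y => φ (x + y) - φ y)]
      calc _ ≤ (a + a) ^ 2 := by gcongr
        _ = 4 * a ^ 2 := by ring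
        _ ≤ _ := by gcongr; exact le_self_add
    · rw [min_eq_right hx]
      refine (hφ.lintegral_translate_sub_le x).trans ?_
      rw [← eLpNorm_two_sq, ENNReal.ofReal_pow (norm_nonneg _), ofReal_norm]
      gcongr
      calc b ^ 2 ≤ (a + b) ^ 2 := by gcongr; exact le_add_self
        _ ≤ 4 * (a + b) ^ 2 := le_mul_of_one_le_left' (by norm_num)
  have hFm : AEMeasurable (fun z : 𝔼 × 𝔼 => ‖fracQuot s φ z‖ₑ ^ 2) (volume.prod volume) :=
    ((aestronglyMeasurable_fracQuot s hφ.memLp.1).enorm).pow_const 2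
  have hφm : Measurable φ := hφ.contDiff.continuous.measurable
  have hm2 : Measurable fun z : 𝔼 × 𝔼 => k z.2 * ‖φ (z.2 + z.1) - φ z.1‖ₑ ^ 2 := by fun_prop
  calc ∫⁻ z, ‖fracQuot s φ z‖ₑ ^ 2
      = ∫⁻ y, ∫⁻ x, ‖fracQuot s φ (x, y)‖ₑ ^ 2 := by
        rw [Measure.volume_eq_prod, lintegral_prod_symm _ hFm]
    _ = ∫⁻ y, ∫⁻ x, k x * ‖φ (x + y) - φ y‖ₑ ^ 2 := by
        refine lintegral_congr fun y => ?_
        rw [← lintegral_add_right_eq_self (fun x => ‖fracQuot s φ (x, y)‖ₑ ^ 2) y]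
        simp only [hker]
    _ = ∫⁻ x, ∫⁻ y, k x * ‖φ (x + y) - φ y‖ₑ ^ 2 := lintegral_lintegral_swap hm2.aemeasurable
    _ ≤ ∫⁻ x : 𝔼, ENNReal.ofReal (min 1 (‖x‖ ^ 2) * ‖x‖ ^ (-((N : ℝ) + 2 * s)))
          * (4 * (a + b) ^ 2) := by
        refine lintegral_mono fun x => ?_
        rw [lintegral_const_mul' _ _ (by simp [hk]), ENNReal.ofReal_mul (by positivity),
          mul_comm (ENNReal.ofReal (min 1 _)), mul_assoc]
        exact mul_le_mul_right (hdiff x) _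
    _ = J * (4 * (a + b) ^ 2) := lintegral_mul_const _ (by fun_prop)
    _ = _ := by
        rw [mul_pow, ← ENNReal.rpow_natCast ((4 * J) ^ (1 / 2 : ℝ)), ← ENNReal.rpow_mul]
        norm_num
        ring

theorem IsTestFunction.sub {Ω : Set 𝔼} {φ ψ : 𝔼 → ℝ} (h : IsTestFunction Ω φ)
    (h' : IsTestFunction Ω ψ) : IsTestFunction Ω (φ - ψ) := by
  rw [sub_eq_add_neg]
  exact h.add (h'.comp_left (F := fun t => -t) contDiff_neg neg_zero)

theorem gradient_sub' {φ ψ : 𝔼 → ℝ} (hφ : Differentiable ℝ φ) (hψ : Differentiable ℝ ψ) :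
    gradient (φ - ψ) = gradient φ - gradient ψ := by
  ext1 x
  refine ext_inner_right ℝ fun v => ?_
  rw [inner_gradient, fderiv_sub (hφ x) (hψ x), Pi.sub_apply, inner_sub_left, inner_gradient,
    inner_gradient]
  rfl

/-- A sequence of test functions converging to `u` in `L²` and almost everywhere, whose gradients
converge to `G` in `L²`. -/
structure IsTestApprox (Ω : Set 𝔼) (u : 𝔼 → ℝ) (G : 𝔼 → 𝔼) (φ : ℕ → 𝔼 → ℝ) : Prop where
  isTestFunction : ∀ n, IsTestFunction Ω (φ n)
  tendsto : Tendsto (fun n => eLpNorm (φ n - u) 2 volume) atTop (𝓝 0)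
  tendsto_gradient : Tendsto (fun n => eLpNorm (gradient (φ n) - G) 2 volume) atTop (𝓝 0)
  tendsto_ae : ∀ᵐ x, Tendsto (fun n => φ n x) atTop (𝓝 (u x))

theorem IsTestLimit.exists_isTestApprox {Ω : Set 𝔼} {u : 𝔼 → ℝ} {G : 𝔼 → 𝔼}
    (h : IsTestLimit Ω u G) (hu : MemLp u 2 volume) : ∃ φ, IsTestApprox Ω u G φ := by
  choose φ h1 h2 h3 using fun n : ℕ => h ((n + 1 : ℕ) : ℝ≥0∞)⁻¹ (by simp)
  have hlim : Tendsto (fun n : ℕ => ((n + 1 : ℕ) : ℝ≥0∞)⁻¹) atTop (𝓝 0) :=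
    (tendsto_add_atTop_iff_nat 1).2 ENNReal.tendsto_inv_nat_nhds_zero
  have t2 := tendsto_of_tendsto_of_tendsto_of_le_of_le tendsto_const_nhds hlim
    (fun n => zero_le) h2
  have t3 := tendsto_of_tendsto_of_tendsto_of_le_of_le tendsto_const_nhds hlim
    (fun n => zero_le) h3
  obtain ⟨ns, hns, hae⟩ := (tendstoInMeasure_of_tendsto_eLpNorm (by norm_num)
    (fun n => (h1 n).memLp.1) hu.1 t2).exists_seq_tendsto_ae
  exact ⟨fun n => φ (ns n), fun n => h1 _, t2.comp hns.tendsto_atTop, t3.comp hns.tendsto_atTop,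
    hae⟩

/-- Convergence in `H¹` implies convergence in the Gagliardo seminorm. -/
theorem IsTestApprox.tendsto_fracQuot (hN : 0 < N) {s : ℝ} (hs : s ∈ Ioo (0 : ℝ) 1)
    {Ω : Set 𝔼} {u : 𝔼 → ℝ} {G : 𝔼 → 𝔼} {φ : ℕ → 𝔼 → ℝ} (h : IsTestApprox Ω u G φ)
    (hu : MemLp u 2 volume) (hG : MemLp G 2 volume) :
    Tendsto (fun n => eLpNorm (fracQuot s u - fracQuot s (φ n)) 2 volume) atTop (𝓝 0) := by
  obtain ⟨C, hCt, hC⟩ := exists_eLpNorm_fracQuot_le hN hs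
  have hT := h.isTestFunction
  have hmeas : ∀ n, AEStronglyMeasurable (fracQuot s (φ n)) volume := fun n =>
    aestronglyMeasurable_fracQuot s (hT n).memLp.1
  have hbound : ∀ m n, eLpNorm (fracQuot s (φ m) - fracQuot s (φ n)) 2 volume
      ≤ C * ((eLpNorm (φ m - u) 2 volume + eLpNorm (φ n - u) 2 volume) +
        (eLpNorm (gradient (φ m) - G) 2 volume + eLpNorm (gradient (φ n) - G) 2 volume)) := by
    intro m n
    rw [← fracQuot_sub]
    have h1 := (hT m).sub (hT n)
    refine (hC _ ⟨h1.contDiff, h1.hasCompactSupport, subset_univ _⟩).trans ?_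
    gcongr
    · rw [← sub_sub_sub_cancel_right (φ m) (φ n) u]
      exact eLpNorm_sub_le ((hT m).memLp.1.sub hu.1) ((hT n).memLp.1.sub hu.1) (by norm_num)
    · rw [gradient_sub' (hT m).differentiable (hT n).differentiable,
        ← sub_sub_sub_cancel_right (gradient (φ m)) (gradient (φ n)) G]
      exact eLpNorm_sub_le ((hT m).memLp_gradient.1.sub hG.1)
        ((hT n).memLp_gradient.1.sub hG.1) (by norm_num)
  have hprod : ∀ᵐ z : 𝔼 × 𝔼,
      Tendsto (fun m => fracQuot s (φ m) z) atTop (𝓝 (fracQuot s u z)) := by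
    have a1 : ∀ᵐ z : 𝔼 × 𝔼, Tendsto (fun n => φ n z.1) atTop (𝓝 (u z.1)) :=
      Measure.quasiMeasurePreserving_fst.ae h.tendsto_ae
    have a2 : ∀ᵐ z : 𝔼 × 𝔼, Tendsto (fun n => φ n z.2) atTop (𝓝 (u z.2)) :=
      Measure.quasiMeasurePreserving_snd.ae h.tendsto_ae
    filter_upwards [a1, a2] with z h1 h2 using (h1.sub h2).div_const _
  have hfatou : ∀ n, eLpNorm (fracQuot s u - fracQuot s (φ n)) 2 volume
      ≤ C * (eLpNorm (φ n - u) 2 volume + eLpNorm (gradient (φ n) - G) 2 volume) := by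
    intro n
    refine (Lp.eLpNorm_lim_le_liminf_eLpNorm (f := fun m => fracQuot s (φ m) - fracQuot s (φ n))
      (fun m => (hmeas m).sub (hmeas n)) _ ?_).trans ?_
    · filter_upwards [hprod] with z hz using hz.sub_const _
    · have hl : Tendsto (fun m => C * ((eLpNorm (φ m - u) 2 volume + eLpNorm (φ n - u) 2 volume) +
          (eLpNorm (gradient (φ m) - G) 2 volume + eLpNorm (gradient (φ n) - G) 2 volume)))
          atTop (𝓝 (C * ((0 + eLpNorm (φ n - u) 2 volume) +
            (0 + eLpNorm (gradient (φ n) - G) 2 volume)))) :=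
        ENNReal.Tendsto.const_mul ((h.tendsto.add_const _).add (h.tendsto_gradient.add_const _))
          (Or.inr hCt)
      rw [zero_add, zero_add] at hl
      rw [← hl.liminf_eq]
      exact liminf_le_liminf (Eventually.of_forall fun m => hbound m n)
  have hl : Tendsto (fun n => C * (eLpNorm (φ n - u) 2 volume
      + eLpNorm (gradient (φ n) - G) 2 volume)) atTop (𝓝 0) := by
    simpa using ENNReal.Tendsto.const_mul (h.tendsto.add h.tendsto_gradient) (Or.inr hCt)
  exact tendsto_of_tendsto_of_tendsto_of_le_of_le tendsto_const_nhds hl (fun n => zero_le) hfatou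

end Gagliardo

/-! ### The energy inequality for truncations -/

section CauchySchwarz

variable {α H : Type*} [MeasurableSpace α] {μ : Measure α} [NormedAddCommGroup H]
  [InnerProductSpace ℝ H]

theorem lintegral_enorm_inner_le {f g : α → H} (hf : AEStronglyMeasurable f μ)
    (hg : AEStronglyMeasurable g μ) :
    ∫⁻ x, ‖(inner ℝ (f x) (g x) : ℝ)‖ₑ ∂μ ≤ eLpNorm f 2 μ * eLpNorm g 2 μ := by
  have key := ENNReal.lintegral_mul_le_Lp_mul_Lq μ (p := 2) (q := 2)
    (Real.HolderConjugate.two_two) hf.enorm hg.enorm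
  have e : ∀ k : α → H, (∫⁻ x, ‖k x‖ₑ ^ (2 : ℝ) ∂μ) ^ (1 / 2 : ℝ) = eLpNorm k 2 μ := fun k => by
    rw [eLpNorm_eq_lintegral_rpow_enorm_toReal (by norm_num) (by norm_num)]
    norm_num
  rw [e, e] at key
  refine (lintegral_mono fun x => ?_).trans key
  simp only [Pi.mul_apply]
  rw [← ofReal_norm, ← ofReal_norm, ← ofReal_norm, ← ENNReal.ofReal_mul (norm_nonneg _)]
  exact ENNReal.ofReal_le_ofReal (norm_inner_le_norm _ _)

theorem integrable_inner_of_memLp {f g : α → H} (hf : MemLp f 2 μ) (hg : MemLp g 2 μ) :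
    Integrable (fun x => (inner ℝ (f x) (g x) : ℝ)) μ :=
  ⟨hf.1.inner hg.1, (lintegral_enorm_inner_le hf.1 hg.1).trans_lt
    (ENNReal.mul_lt_top hf.2 hg.2)⟩

/-- If `f n → 0` in `L²` and `g n` is dominated by a multiple of a sequence that converges in `L²`,
then `∫ ⟨f n, g n⟩ → 0`. -/
theorem tendsto_integral_inner_zero {f g h : ℕ → α → H} {k : α → H} {B : ℝ}
    (hf : ∀ n, AEStronglyMeasurable (f n) μ) (hg : ∀ n, AEStronglyMeasurable (g n) μ)
    (hh : ∀ n, AEStronglyMeasurable (h n) μ) (hk : MemLp k 2 μ)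
    (hgh : ∀ n x, ‖g n x‖ ≤ B * ‖h n x‖)
    (hf0 : Tendsto (fun n => eLpNorm (f n) 2 μ) atTop (𝓝 0))
    (hhk : Tendsto (fun n => eLpNorm (h n - k) 2 μ) atTop (𝓝 0)) :
    Tendsto (fun n => ∫ x, (inner ℝ (f n x) (g n x) : ℝ) ∂μ) atTop (𝓝 0) := by
  rw [tendsto_zero_iff_enorm_tendsto_zero]
  have hb : ∀ n, ‖∫ x, (inner ℝ (f n x) (g n x) : ℝ) ∂μ‖ₑ ≤
      eLpNorm (f n) 2 μ * (ENNReal.ofReal B * (eLpNorm (h n - k) 2 μ + eLpNorm k 2 μ)) := by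
    intro n
    refine (enorm_integral_le_lintegral_enorm _).trans
      ((lintegral_enorm_inner_le (hf n) (hg n)).trans ?_)
    gcongr
    refine (eLpNorm_le_mul_eLpNorm_of_ae_le_mul (ae_of_all _ (hgh n)) 2).trans ?_
    gcongr
    calc eLpNorm (h n) 2 μ = eLpNorm ((h n - k) + k) 2 μ := by rw [sub_add_cancel]
      _ ≤ _ := eLpNorm_add_le ((hh n).sub hk.1) hk.1 (by norm_num)
  have h2 : Tendsto (fun n => ENNReal.ofReal B * (eLpNorm (h n - k) 2 μ + eLpNorm k 2 μ)) atTop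
      (𝓝 (ENNReal.ofReal B * (0 + eLpNorm k 2 μ))) :=
    ENNReal.Tendsto.const_mul (hhk.add_const _) (Or.inr ENNReal.ofReal_ne_top)
  have h3 := ENNReal.Tendsto.mul hf0
    (Or.inr (ENNReal.mul_ne_top ENNReal.ofReal_ne_top (by simpa using hk.2.ne))) h2
    (Or.inr (by simp))
  rw [zero_mul] at h3
  exact tendsto_of_tendsto_of_tendsto_of_le_of_le tendsto_const_nhds h3 (fun n => zero_le) hb

end CauchySchwarz

/-- A pair of smooth nonlinearities adapted to truncation: `T` plays the role of the truncated
function and `ψ`, with `ψ' = T'²`, that of the corresponding test function. The constants `B` and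
`L` bound `T'` and `ψ`. -/
structure IsTruncationPair (T ψ : ℝ → ℝ) (B L : ℝ) : Prop where
  contDiff_fst : ContDiff ℝ ∞ T
  contDiff_snd : ContDiff ℝ ∞ ψ
  fst_zero : T 0 = 0
  snd_zero : ψ 0 = 0
  deriv_snd : ∀ t, deriv ψ t = deriv T t ^ 2
  abs_deriv_le : ∀ t, |deriv T t| ≤ B
  abs_snd_le : ∀ t, |ψ t| ≤ L

namespace IsTruncationPair

variable {T ψ : ℝ → ℝ} {B L : ℝ}

theorem monotone (h : IsTruncationPair T ψ B L) : Monotone ψ :=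
  monotone_of_deriv_nonneg (h.contDiff_snd.differentiable (by simp)) fun t => by
    rw [h.deriv_snd]; positivity

theorem abs_deriv_snd_le (h : IsTruncationPair T ψ B L) (t : ℝ) : |deriv ψ t| ≤ B ^ 2 := by
  rw [h.deriv_snd, abs_pow]
  exact pow_le_pow_left₀ (abs_nonneg _) (h.abs_deriv_le t) 2

theorem abs_sub_le (h : IsTruncationPair T ψ B L) (a b : ℝ) : |ψ a - ψ b| ≤ B ^ 2 * |a - b| :=
  Convex.norm_image_sub_le_of_norm_deriv_le (𝕜 := ℝ) (s := univ)
    (fun x _ => (h.contDiff_snd.differentiable (by simp)) x)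
    (fun x _ => h.abs_deriv_snd_le x) convex_univ (mem_univ b) (mem_univ a)

end IsTruncationPair

theorem fracConst_nonneg (N : ℕ) [NeZero N] (s : ℝ) : 0 ≤ fracConst N s :=
  inv_nonneg.2 (integral_nonneg fun _ =>
    div_nonneg (sub_nonneg.2 (Real.cos_le_one _)) (Real.rpow_nonneg (norm_nonneg _) _))

section Energy

variable {N : ℕ} [NeZero N]

local notation "𝔼" => EuclideanSpace ℝ (Fin N)

/-- The weak form tested with `ψ ∘ φ n`, where `φ n` approximates `u`, dominates the Dirichlet
energy of `T ∘ φ n` up to a vanishing error: replacing `u` by `φ n` costs nothing in the limit, and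
the nonlocal part is nonnegative because `ψ` is monotone. -/
theorem exists_energy_le {s : ℝ} (hs : s ∈ Ioo (0 : ℝ) 1)
    {Ω : Set 𝔼} (hΩ : IsOpen Ω) {u : 𝔼 → ℝ} {G G' : 𝔼 → 𝔼} (hu : MemLp u 2 volume)
    (hG' : MemLp G' 2 volume) (hGG' : ∀ x ∈ Ω, G' x = G x) {φ : ℕ → 𝔼 → ℝ}
    (hφ : IsTestApprox Ω u G' φ) {T ψ : ℝ → ℝ} {B L : ℝ} (hTψ : IsTruncationPair T ψ B L) :
    ∃ e : ℕ → ℝ, Tendsto e atTop (𝓝 0) ∧ ∀ n,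
      ∫ x, ‖gradient (T ∘ φ n) x‖ ^ 2 ≤ weakForm Ω s u G (ψ ∘ φ n) + e n := by
  have hN : 0 < N := Nat.pos_of_ne_zero (NeZero.ne N)
  have hT := hφ.isTestFunction
  have hψT : ∀ n, IsTestFunction Ω (ψ ∘ φ n) := fun n =>
    (hT n).comp_left hTψ.contDiff_snd hTψ.snd_zero
  have hTd : Differentiable ℝ T := hTψ.contDiff_fst.differentiable (by simp)
  have hψd : Differentiable ℝ ψ := hTψ.contDiff_snd.differentiable (by simp)
  have hB2 : ∀ t, |deriv ψ t| ≤ B ^ 2 := hTψ.abs_deriv_snd_le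
  obtain ⟨C, hCt, hC⟩ := exists_eLpNorm_fracQuot_le (N := N) hN hs
  have hQ : ∀ n, MemLp (fracQuot s (φ n)) 2 volume := fun n =>
    ⟨aestronglyMeasurable_fracQuot s (hT n).memLp.1,
      (hC _ ⟨(hT n).contDiff, (hT n).hasCompactSupport, subset_univ _⟩).trans_lt
        (ENNReal.mul_lt_top hCt.lt_top (ENNReal.add_lt_top.2 ⟨(hT n).memLp.2,
          (hT n).memLp_gradient.2⟩))⟩
  have hQψ : ∀ n, MemLp (fracQuot s (ψ ∘ φ n)) 2 volume := fun n =>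
    ⟨aestronglyMeasurable_fracQuot s (hψT n).memLp.1,
      (hC _ ⟨(hψT n).contDiff, (hψT n).hasCompactSupport, subset_univ _⟩).trans_lt
        (ENNReal.mul_lt_top hCt.lt_top (ENNReal.add_lt_top.2 ⟨(hψT n).memLp.2,
          (hψT n).memLp_gradient.2⟩))⟩
  have hQlim := hφ.tendsto_fracQuot hN hs hu hG'
  have hQu : MemLp (fracQuot s u) 2 volume := by
    refine ⟨aestronglyMeasurable_fracQuot s hu.1, ?_⟩
    obtain ⟨n, hn⟩ := (hQlim.eventually_lt_const one_pos).exists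
    calc eLpNorm (fracQuot s u) 2 volume
        = eLpNorm ((fracQuot s u - fracQuot s (φ n)) + fracQuot s (φ n)) 2 volume := by
          rw [sub_add_cancel]
      _ ≤ _ := eLpNorm_add_le (((aestronglyMeasurable_fracQuot s hu.1)).sub (hQ n).1) (hQ n).1
          (by norm_num)
      _ < ⊤ := ENNReal.add_lt_top.2 ⟨hn.trans ENNReal.one_lt_top, (hQ n).2⟩
  have hgrad : ∀ n x, gradient (ψ ∘ φ n) x = deriv ψ (φ n x) • gradient (φ n) x := fun n x =>
    gradient_comp hψd (hT n).differentiable x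
  -- the two errors made by replacing `u` by `φ n` in the local and in the nonlocal part
  set e₁ : ℕ → ℝ := fun n => ∫ x, inner ℝ ((gradient (φ n) - G') x) (gradient (ψ ∘ φ n) x) with he₁
  set e₂ : ℕ → ℝ := fun n =>
    ∫ z, inner ℝ ((fracQuot s u - fracQuot s (φ n)) z) (fracQuot s (ψ ∘ φ n) z) with he₂
  have h₁ : Tendsto e₁ atTop (𝓝 0) := by
    refine tendsto_integral_inner_zero (B := B ^ 2) (h := fun n => gradient (φ n)) (k := G')
      (fun n => (hT n).memLp_gradient.1.sub hG'.1) (fun n => (hψT n).memLp_gradient.1)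
      (fun n => (hT n).memLp_gradient.1) hG' (fun n x => ?_) hφ.tendsto_gradient
      hφ.tendsto_gradient
    rw [hgrad, norm_smul]
    exact mul_le_mul_of_nonneg_right (hB2 _) (norm_nonneg _)
  have h₂ : Tendsto e₂ atTop (𝓝 0) := by
    refine tendsto_integral_inner_zero (B := B ^ 2) (h := fun n => fracQuot s (φ n))
      (k := fracQuot s u) (fun n => hQu.1.sub (hQ n).1) (fun n => (hQψ n).1)
      (fun n => (hQ n).1) hQu (fun n z => ?_) hQlim ?_
    · simp only [fracQuot, Function.comp_apply, norm_div]
      rw [← mul_div_assoc]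
      gcongr
      exact hTψ.abs_sub_le _ _
    · simpa only [eLpNorm_sub_comm] using hQlim
  refine ⟨fun n => e₁ n - fracConst N s / 2 * e₂ n, by simpa using h₁.sub (h₂.const_mul _),
    fun n => ?_⟩
  have hsupp : ∀ x, x ∉ Ω → gradient (ψ ∘ φ n) x = 0 := by
    intro x hx
    have h0 : x ∉ tsupport (gradient (ψ ∘ φ n)) := fun hc => by
      have h1 : tsupport (gradient (ψ ∘ φ n)) ⊆ tsupport (fderiv ℝ (ψ ∘ φ n)) :=
        tsupport_comp_subset (map_zero (InnerProductSpace.toDual ℝ 𝔼).symm) _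
      exact hx ((hψT n).tsupport_subset (tsupport_fderiv_subset ℝ (h1 hc)))
    exact image_eq_zero_of_notMem_tsupport h0
  have hloc : ∫ x in Ω, inner ℝ (G x) (gradient (ψ ∘ φ n) x)
      = (∫ x, ‖gradient (T ∘ φ n) x‖ ^ 2) - e₁ n := by
    have i1 := integrable_inner_of_memLp (hT n).memLp_gradient (hψT n).memLp_gradient
    have i2 := integrable_inner_of_memLp ((hT n).memLp_gradient.sub hG') (hψT n).memLp_gradient
    have step1 : ∫ x in Ω, inner ℝ (G x) (gradient (ψ ∘ φ n) x)
        = ∫ x, inner ℝ (G' x) (gradient (ψ ∘ φ n) x) := by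
      refine (setIntegral_congr_fun hΩ.measurableSet fun x hx => ?_).trans
        (setIntegral_eq_integral_of_forall_compl_eq_zero fun x hx => ?_)
      · simp only [hGG' x hx]
      · rw [hsupp x hx, inner_zero_right]
    have step2 : ∀ x, ‖gradient (T ∘ φ n) x‖ ^ 2
        = inner ℝ (gradient (φ n) x) (gradient (ψ ∘ φ n) x) := fun x => by
      rw [gradient_comp hTd (hT n).differentiable, hgrad, norm_smul, inner_smul_right,
        real_inner_self_eq_norm_sq, hTψ.deriv_snd, mul_pow, Real.norm_eq_abs, sq_abs]
    simp only [step1, step2]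
    rw [he₁, ← integral_sub i1 i2]
    refine integral_congr_ae (ae_of_all _ fun x => ?_)
    simp
  have hnonloc : e₂ n ≤ ∫ z : 𝔼 × 𝔼, (u z.1 - u z.2) * ((ψ ∘ φ n) z.1 - (ψ ∘ φ n) z.2)
      / ‖z.1 - z.2‖ ^ ((N : ℝ) + 2 * s) := by
    have i1 := integrable_inner_of_memLp (hQu.sub (hQ n)) (hQψ n)
    have i2 := integrable_inner_of_memLp hQu (hQψ n)
    have e : ∀ z : 𝔼 × 𝔼, (u z.1 - u z.2) * ((ψ ∘ φ n) z.1 - (ψ ∘ φ n) z.2)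
        / ‖z.1 - z.2‖ ^ ((N : ℝ) + 2 * s)
        = inner ℝ (fracQuot s u z) (fracQuot s (ψ ∘ φ n) z) := fun z => by
      rw [fracQuot_mul_fracQuot hs.1]; simp [mul_comm]
    simp only [e]
    refine integral_mono i1 i2 fun z => ?_
    have hpos : 0 ≤ fracQuot s (φ n) z * fracQuot s (ψ ∘ φ n) z := by
      rw [← fracQuot_mul_fracQuot hs.1]
      refine div_nonneg ?_ (Real.rpow_nonneg (norm_nonneg _) _)
      rcases le_total (φ n z.1) (φ n z.2) with hle | hle
      · exact mul_nonneg_of_nonpos_of_nonpos (sub_nonpos.2 hle)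
          (sub_nonpos.2 (hTψ.monotone hle))
      · exact mul_nonneg (sub_nonneg.2 hle) (sub_nonneg.2 (hTψ.monotone hle))
    simp only [Pi.sub_apply, inner_sub_left, sub_le_self_iff]
    simpa [mul_comm] using hpos
  have hc : 0 ≤ fracConst N s / 2 := by have := fracConst_nonneg N s; positivity
  have := mul_le_mul_of_nonneg_left hnonloc hc
  rw [weakForm, hloc]
  linarith

/-- Sobolev's inequality for `T ∘ u`, with the energy bounded through the equation. -/
theorem IsWeakSolution.eLpNorm_truncation_sq_le (hN : 3 ≤ N) {s : ℝ} (hs : s ∈ Ioo (0 : ℝ) 1)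
    {Ω : Set 𝔼} (hΩ : IsOpen Ω) (hb : Bornology.IsBounded Ω) (hC : HasC1Boundary Ω)
    {f u : 𝔼 → ℝ} (hf : IntegrableOn f Ω volume) (hsol : IsWeakSolution Ω s f u) {T ψ : ℝ → ℝ}
    {B L : ℝ} (hTψ : IsTruncationPair T ψ B L) {q : ℝ≥0}
    (hq : (q : ℝ)⁻¹ = 2⁻¹ - (N : ℝ)⁻¹) :
    eLpNorm (T ∘ u) q volume ^ 2
      ≤ (SNormLESNormFDerivOfEqConst ℝ (volume : Measure 𝔼) 2 : ℝ≥0∞) ^ 2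
        * ENNReal.ofReal (∫ x in Ω, f x * ψ (u x)) := by
  obtain ⟨⟨G, hG, hsolG⟩, -, h0⟩ := hsol
  obtain ⟨G', hG', hGG', hlim⟩ := hG.exists_isTestLimit hΩ hb hC h0
  obtain ⟨φ, hφ⟩ := hlim.exists_isTestApprox hG.memLp
  obtain ⟨e, he, hen⟩ := exists_energy_le hs hΩ hG.memLp hG' hGG' hφ hTψ
  have hT := hφ.isTestFunction
  set S : ℝ≥0∞ := (SNormLESNormFDerivOfEqConst ℝ (volume : Measure 𝔼) 2 : ℝ≥0∞) with hS
  have hTT : ∀ n, IsTestFunction Ω (T ∘ φ n) := fun n =>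
    (hT n).comp_left hTψ.contDiff_fst hTψ.fst_zero
  have hsob : ∀ n, eLpNorm (T ∘ φ n) q volume ^ 2
      ≤ S ^ 2 * ENNReal.ofReal ((∫ x in Ω, f x * ψ (φ n x)) + e n) := by
    intro n
    have h1 : eLpNorm (T ∘ φ n) q volume ≤ S * eLpNorm (fderiv ℝ (T ∘ φ n)) 2 volume := by
      have := eLpNorm_le_eLpNorm_fderiv_of_eq (volume : Measure 𝔼) (F := ℝ) (u := T ∘ φ n)
        (p := 2) (p' := q) ((hTT n).contDiff.of_le (by simp)) (hTT n).hasCompactSupport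
        (by norm_num) (by rw [finrank_euclideanSpace_fin]; omega)
        (by rw [finrank_euclideanSpace_fin]; simpa using hq)
      simpa using this
    have h2 : eLpNorm (fderiv ℝ (T ∘ φ n)) 2 volume = eLpNorm (gradient (T ∘ φ n)) 2 volume :=
      eLpNorm_congr_norm_ae (ae_of_all _ fun x => (norm_gradient _ _).symm)
    have h3 : eLpNorm (gradient (T ∘ φ n)) 2 volume ^ 2
        = ENNReal.ofReal (∫ x, ‖gradient (T ∘ φ n) x‖ ^ 2) := by
      rw [eLpNorm_two_sq, ofReal_integral_eq_lintegral_ofReal _ (ae_of_all _ fun x => by positivity)]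
      · refine lintegral_congr fun x => ?_
        rw [ENNReal.ofReal_pow (norm_nonneg _), ofReal_norm]
      · simpa only [real_inner_self_eq_norm_sq] using
          integrable_inner_of_memLp (hTT n).memLp_gradient (hTT n).memLp_gradient
    have h4 := hen n
    rw [hsolG _ ((hT n).comp_left hTψ.contDiff_snd hTψ.snd_zero)] at h4
    calc _ ≤ (S * eLpNorm (gradient (T ∘ φ n)) 2 volume) ^ 2 := by rw [← h2]; gcongr
      _ = S ^ 2 * ENNReal.ofReal (∫ x, ‖gradient (T ∘ φ n) x‖ ^ 2) := by rw [mul_pow, h3]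
      _ ≤ _ := by gcongr; exact h4
  have hψc : Continuous ψ := hTψ.contDiff_snd.continuous
  have hrhs : Tendsto (fun n => (∫ x in Ω, f x * ψ (φ n x)) + e n) atTop
      (𝓝 (∫ x in Ω, f x * ψ (u x))) := by
    rw [← add_zero (∫ x in Ω, f x * ψ (u x))]
    refine Tendsto.add ?_ he
    refine tendsto_integral_of_dominated_convergence (fun x => ‖f x‖ * L) (fun n => ?_)
      (hf.norm.mul_const _) (fun n => ae_of_all _ fun x => ?_) ?_
    · exact hf.1.mul (hψc.comp (hT n).contDiff.continuous).aestronglyMeasurable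
    · rw [norm_mul]
      exact mul_le_mul_of_nonneg_left (hTψ.abs_snd_le _) (norm_nonneg _)
    · filter_upwards [ae_restrict_of_ae hφ.tendsto_ae] with x hx
      exact ((hψc.tendsto _).comp hx).const_mul _
  have hrhs' : Tendsto (fun n => (S ^ 2 *
      ENNReal.ofReal ((∫ x in Ω, f x * ψ (φ n x)) + e n)) ^ (1 / 2 : ℝ)) atTop
      (𝓝 ((S ^ 2 * ENNReal.ofReal (∫ x in Ω, f x * ψ (u x))) ^ (1 / 2 : ℝ))) :=
    (ENNReal.Tendsto.const_mul (ENNReal.tendsto_ofReal hrhs)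
      (Or.inr (by simp [hS]))).ennrpow_const _
  have hsq : ∀ a : ℝ≥0∞, (a ^ (1 / 2 : ℝ)) ^ 2 = a := fun a => by
    rw [← ENNReal.rpow_natCast, ← ENNReal.rpow_mul]; norm_num
  have hfatou : eLpNorm (T ∘ u) q volume
      ≤ (S ^ 2 * ENNReal.ofReal (∫ x in Ω, f x * ψ (u x))) ^ (1 / 2 : ℝ) := by
    refine (Lp.eLpNorm_lim_le_liminf_eLpNorm (f := fun n => T ∘ φ n)
      (fun n => (hTT n).contDiff.continuous.aestronglyMeasurable) _ ?_).trans ?_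
    · filter_upwards [hφ.tendsto_ae] with x hx
      exact (hTψ.contDiff_fst.continuous.tendsto _).comp hx
    · rw [← hrhs'.liminf_eq]
      refine liminf_le_liminf (Eventually.of_forall fun n => ?_)
      rw [← ENNReal.pow_le_pow_left_iff two_ne_zero, hsq]
      exact hsob n
  calc _ ≤ ((S ^ 2 * ENNReal.ofReal (∫ x in Ω, f x * ψ (u x))) ^ (1 / 2 : ℝ)) ^ 2 := by gcongr
    _ = _ := hsq _

end Energy

/-! ### Level sets and Stampacchia's iteration -/

/-- Truncation pairs between the levels `k` and `k + d`, the bound on `ψ` scaling like `1 / d`. -/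
theorem exists_isTruncationPair : ∃ L : ℝ, 0 ≤ L ∧ ∀ k d : ℝ, 0 ≤ k → 0 < d →
    ∃ (T ψ : ℝ → ℝ) (B : ℝ), IsTruncationPair T ψ B (L / d) ∧ (∀ t ≤ k, ψ t = 0) ∧
      ∀ t, k + d ≤ t → T t = 1 := by
  set T₀ : ℝ → ℝ := Real.smoothTransition with hT₀
  have hTs : ContDiff ℝ ∞ T₀ := Real.smoothTransition.contDiff
  set g : ℝ → ℝ := deriv T₀ with hg
  have hgs : ContDiff ℝ ∞ g := (contDiff_infty_iff_deriv.1 hTs).2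
  have hgc : Continuous g := hgs.continuous
  have hg0 : ∀ t ≤ 0, g t = 0 := fun t ht => by
    have h1 : IsLocalMin T₀ t := Eventually.of_forall fun x => by
      rw [hT₀, Real.smoothTransition.zero_of_nonpos ht]
      exact Real.smoothTransition.nonneg x
    exact h1.deriv_eq_zero
  have hg1 : ∀ t, 1 ≤ t → g t = 0 := fun t ht => by
    have h1 : IsLocalMax T₀ t := Eventually.of_forall fun x => by
      rw [hT₀, Real.smoothTransition.one_of_one_le ht]
      exact Real.smoothTransition.le_one x
    exact h1.deriv_eq_zero
  have hgsupp : HasCompactSupport g := HasCompactSupport.intro (isCompact_Icc (a := (0 : ℝ)) (b := 1))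
    fun t ht => by
      by_cases h0 : t ≤ 0
      · exact hg0 t h0
      · exact hg1 t (not_lt.1 fun h1 => ht ⟨(not_le.1 h0).le, h1.le⟩)
  obtain ⟨B, hB⟩ := hgsupp.exists_bound_of_continuous hgc
  have hg2c : Continuous fun t => g t ^ 2 := hgc.pow 2
  have hg2i : Integrable (fun t => g t ^ 2) volume :=
    hg2c.integrable_of_hasCompactSupport (hgsupp.comp_left (g := fun y : ℝ => y ^ 2) (by simp))
  set Ψ : ℝ → ℝ := fun x => ∫ t in (0 : ℝ)..x, g t ^ 2 with hΨ
  have hΨd : ∀ x, HasDerivAt Ψ (g x ^ 2) x := fun x =>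
    intervalIntegral.integral_hasDerivAt_right (hg2c.intervalIntegrable _ _)
      (hg2c.stronglyMeasurableAtFilter _ _) hg2c.continuousAt
  have hΨs : ContDiff ℝ ∞ Ψ := contDiff_infty_iff_deriv.2
    ⟨fun x => (hΨd x).differentiableAt, by
      rw [show deriv Ψ = fun x => g x ^ 2 from funext fun x => (hΨd x).deriv]
      exact hgs.pow 2⟩
  have hΨ0 : ∀ x ≤ 0, Ψ x = 0 := fun x hx => by
    rw [hΨ]
    refine (intervalIntegral.integral_congr (g := fun _ => (0 : ℝ)) fun t ht => ?_).trans (by simp)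
    rw [uIcc_of_ge hx] at ht
    simp [hg0 t ht.2]
  set L : ℝ := ∫ t, g t ^ 2 with hL
  have hΨL : ∀ x, |Ψ x| ≤ L := fun x => by
    refine (intervalIntegral.norm_integral_le_integral_norm_uIoc (μ := volume)
      (f := fun t => g t ^ 2) (a := 0) (b := x)).trans ?_
    simp only [norm_pow, Real.norm_eq_abs, sq_abs]
    exact setIntegral_le_integral hg2i (ae_of_all _ fun t => by positivity)
  refine ⟨L, (abs_nonneg _).trans (hΨL 0), fun k d hk hd =>
    ⟨fun t => T₀ ((t - k) / d), fun t => Ψ ((t - k) / d) / d, B / d, ?_, fun t ht => ?_,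
      fun t ht => ?_⟩⟩
  · have hlin : ContDiff ℝ ∞ fun t : ℝ => (t - k) / d := by fun_prop
    have hlind : ∀ t : ℝ, HasDerivAt (fun t : ℝ => (t - k) / d) (1 / d) t := fun t =>
      ((hasDerivAt_id t).sub_const k).div_const d
    have hTd : ∀ t, deriv (fun t => T₀ ((t - k) / d)) t = g ((t - k) / d) * (1 / d) := fun t =>
      (((hTs.differentiable (by simp)) _).hasDerivAt.comp t (hlind t)).deriv
    have hnp : (0 - k) / d ≤ 0 := div_nonpos_of_nonpos_of_nonneg (by linarith) hd.le
    refine ⟨hTs.comp hlin, (hΨs.comp hlin).div_const d,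
      Real.smoothTransition.zero_of_nonpos hnp, by simp only [hΨ0 _ hnp, zero_div], fun t => ?_,
      fun t => ?_, fun t => ?_⟩
    · have h1 : HasDerivAt (fun t => Ψ ((t - k) / d) / d) (g ((t - k) / d) ^ 2 * (1 / d) / d) t :=
        ((hΨd _).comp t (hlind t)).div_const d
      rw [hTd, h1.deriv]
      ring
    · rw [hTd, abs_mul, abs_of_pos (one_div_pos.2 hd), mul_one_div]
      exact div_le_div_of_nonneg_right (hB _) hd.le
    · rw [abs_div, abs_of_pos hd]
      exact div_le_div_of_nonneg_right (hΨL _) hd.le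
  · simp [hΨ0 _ (div_nonpos_of_nonpos_of_nonneg (sub_nonpos.2 ht) hd.le)]
  · exact Real.smoothTransition.one_of_one_le ((one_le_div hd).2 (by linarith))

/-- Stampacchia's lemma: a nonincreasing function `a` on `[0, ∞)` whose decay improves
superlinearly from one level to the next vanishes beyond a level proportional to `M`. -/
theorem exists_stampacchia_level {σ θ V : ℝ} (hσ : 0 < σ) (hσθ : σ < θ) (hV : 0 < V) :
    ∃ D : ℝ, 0 < D ∧ ∀ (a : ℝ → ℝ) (M K : ℝ), Antitone a → (∀ k, 0 ≤ a k) → a 0 ≤ V →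
      (∀ k h, 0 ≤ k → k < h → a h ^ σ ≤ M / (h - k) * a k ^ θ) →
      0 ≤ M → 0 < K → D * M ≤ K → a K = 0 := by
  set q : ℝ := 2 ^ (-(θ - σ)⁻¹) with hq
  have hθσ : 0 < θ - σ := sub_pos.2 hσθ
  have hq0 : 0 < q := Real.rpow_pos_of_pos two_pos _
  have hq1 : q < 1 := Real.rpow_lt_one_of_one_lt_of_neg one_lt_two (by simpa using hθσ)
  -- `q` is the ratio for which the growth `2 ^ n` of the inverse gaps is absorbed
  have hqp : 2 * q ^ θ = q ^ σ := by
    have h1 : q ^ (θ - σ) = 2⁻¹ := by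
      rw [hq, ← Real.rpow_mul two_pos.le, neg_mul, inv_mul_cancel₀ hθσ.ne', Real.rpow_neg_one]
    have h2 : q ^ θ = q ^ (θ - σ) * q ^ σ := by rw [← Real.rpow_add hq0, sub_add_cancel]
    rw [h2, h1]; ring
  have hVq : 0 < (V * q) ^ σ := Real.rpow_pos_of_pos (by positivity) _
  have hVθ : 0 < V ^ θ := Real.rpow_pos_of_pos hV _
  refine ⟨2 * V ^ θ / (V * q) ^ σ, by positivity, fun a M K ha ha0 haV hdec hM hK hDK => ?_⟩
  rw [div_mul_eq_mul_div, div_le_iff₀ hVq] at hDK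
  have hclaim : ∀ n : ℕ, a (K * (1 - 2⁻¹ ^ n)) ≤ V * q ^ n := by
    intro n
    induction n with
    | zero => simpa using haV
    | succ n ih =>
      have hp : (0 : ℝ) < 2⁻¹ ^ n := by positivity
      have hp1 : (2⁻¹ : ℝ) ^ n ≤ 1 := pow_le_one₀ (by norm_num) (by norm_num)
      have hk0 : 0 ≤ K * (1 - 2⁻¹ ^ n) := mul_nonneg hK.le (by linarith)
      have hgap : K * (1 - 2⁻¹ ^ (n + 1)) - K * (1 - 2⁻¹ ^ n) = K * 2⁻¹ ^ (n + 1) := by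
        rw [pow_succ]; ring
      have hgap0 : 0 < K * (2⁻¹ : ℝ) ^ (n + 1) := by positivity
      have h1 := hdec _ (K * (1 - 2⁻¹ ^ (n + 1))) hk0 (by linarith)
      rw [hgap] at h1
      rw [← Real.rpow_le_rpow_iff (ha0 _) (by positivity) hσ]
      refine h1.trans ?_
      have h2 : a (K * (1 - 2⁻¹ ^ n)) ^ θ ≤ (V * q ^ n) ^ θ :=
        Real.rpow_le_rpow (ha0 _) ih (hσ.trans hσθ).le
      have e1 : (V * q ^ n) ^ θ = V ^ θ * (q ^ θ) ^ n := by
        rw [Real.mul_rpow hV.le (by positivity), ← Real.rpow_natCast, ← Real.rpow_natCast,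
          ← Real.rpow_mul hq0.le, ← Real.rpow_mul hq0.le, mul_comm θ]
      have e2 : (V * q ^ (n + 1)) ^ σ = (V * q) ^ σ * (2 ^ n * (q ^ θ) ^ n) := by
        rw [← mul_pow, hqp, pow_succ', ← mul_assoc, Real.mul_rpow (by positivity) (by positivity),
          ← Real.rpow_natCast q, ← Real.rpow_natCast (q ^ σ), ← Real.rpow_mul hq0.le,
          ← Real.rpow_mul hq0.le, mul_comm σ]
      calc M / (K * 2⁻¹ ^ (n + 1)) * a (K * (1 - 2⁻¹ ^ n)) ^ θ
          ≤ M / (K * 2⁻¹ ^ (n + 1)) * (V ^ θ * (q ^ θ) ^ n) := by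
            rw [← e1]; gcongr
        _ = (2 * V ^ θ * M) / K * (2 ^ n * (q ^ θ) ^ n) := by
            rw [inv_pow, pow_succ]
            field_simp
        _ ≤ (V * q) ^ σ * (2 ^ n * (q ^ θ) ^ n) := by
            have h3 : (2 * V ^ θ * M) / K ≤ (V * q) ^ σ := by
              rw [div_le_iff₀ hK, mul_comm _ K]; exact hDK
            have h4 : 0 ≤ q ^ θ := Real.rpow_nonneg hq0.le _
            exact mul_le_mul_of_nonneg_right h3 (by positivity)
        _ = _ := e2.symm
  have hlim : Tendsto (fun n : ℕ => V * q ^ n) atTop (𝓝 0) := by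
    simpa using (tendsto_pow_atTop_nhds_zero_of_lt_one hq0.le hq1).const_mul V
  refine le_antisymm (ge_of_tendsto' hlim fun n => ?_) (ha0 K)
  refine (ha ?_).trans (hclaim n)
  have hp : (0 : ℝ) < 2⁻¹ ^ n := by positivity
  nlinarith

section LevelSets

variable {N : ℕ} [NeZero N]

local notation "𝔼" => EuclideanSpace ℝ (Fin N)

/-- The decay of the measures of the superlevel sets of a weak solution. -/
theorem exists_measure_superlevel_le (hN : 3 ≤ N) {s : ℝ} (hs : s ∈ Ioo (0 : ℝ) 1)
    {Ω : Set 𝔼} (hΩ : IsOpen Ω) (hb : Bornology.IsBounded Ω) (hC : HasC1Boundary Ω)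
    {p : ℝ≥0∞} (hp : 1 ≤ p) {q : ℝ≥0} (hq0 : 0 < q) (hq : (q : ℝ)⁻¹ = 2⁻¹ - (N : ℝ)⁻¹) :
    ∃ C : ℝ, 0 ≤ C ∧ ∀ f u : 𝔼 → ℝ, MemLp f p (volume.restrict Ω) → IsWeakSolution Ω s f u →
      ∀ k h : ℝ, 0 ≤ k → k < h →
        volume {x | h < u x} ^ (2 / (q : ℝ)) ≤ ENNReal.ofReal (C / (h - k))
          * (eLpNorm f p (volume.restrict Ω) * volume {x | k < u x} ^ (1 - 1 / p.toReal)) := by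
  obtain ⟨L, hL0, hL⟩ := exists_isTruncationPair
  set S : ℝ≥0 := SNormLESNormFDerivOfEqConst ℝ (volume : Measure 𝔼) 2 with hS
  refine ⟨(S : ℝ) ^ 2 * L, by positivity, fun f u hf hu k h hk hkh => ?_⟩
  have hd : 0 < h - k := sub_pos.2 hkh
  obtain ⟨T, ψ, B, hTψ, hψ0, hT1⟩ := hL k (h - k) hk hd
  have : IsFiniteMeasure (volume.restrict Ω) :=
    ⟨by rw [Measure.restrict_apply_univ]; exact hb.measure_lt_top⟩
  have hu1 : AEStronglyMeasurable u volume := hu.1.choose_spec.1.memLp.1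
  have hTu : AEStronglyMeasurable (T ∘ u) volume :=
    hTψ.contDiff_fst.continuous.comp_aestronglyMeasurable hu1
  have hlow : volume {x | h < u x} ≤ eLpNorm (T ∘ u) q volume ^ (q : ℝ) := by
    have h1 := meas_ge_le_mul_pow_eLpNorm_enorm volume (p := (q : ℝ≥0∞)) (by simpa using hq0.ne')
      (by simp) hTu (ε := 1) (by simp) (by simp)
    simp only [inv_one, ENNReal.one_rpow, one_mul, ENNReal.coe_toReal] at h1
    refine (measure_mono fun x hx => ?_).trans h1
    have h2 : T (u x) = 1 := hT1 _ (by rw [add_sub_cancel]; exact le_of_lt hx)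
    simp [h2]
  have hA : NullMeasurableSet {x | k < u x} (volume.restrict Ω) :=
    (nullMeasurableSet_lt aemeasurable_const hu1.aemeasurable).mono_ac
      Measure.absolutelyContinuous_restrict
  have hup : ENNReal.ofReal (∫ x in Ω, f x * ψ (u x)) ≤ ENNReal.ofReal (L / (h - k)) *
      (eLpNorm f p (volume.restrict Ω) * volume {x | k < u x} ^ (1 - 1 / p.toReal)) := by
    calc ENNReal.ofReal (∫ x in Ω, f x * ψ (u x))
        ≤ ‖∫ x in Ω, f x * ψ (u x)‖ₑ := Real.ofReal_le_enorm _
      _ ≤ ∫⁻ x in Ω, ‖f x * ψ (u x)‖ₑ := enorm_integral_le_lintegral_enorm _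
      _ ≤ ∫⁻ x in Ω, {x | k < u x}.indicator (fun x => ENNReal.ofReal (L / (h - k)) * ‖f x‖ₑ) x := by
          refine lintegral_mono fun x => ?_
          by_cases hx : k < u x
          · rw [indicator_of_mem (show x ∈ {x | k < u x} from hx), enorm_mul, mul_comm]
            gcongr
            rw [← ofReal_norm]
            exact ENNReal.ofReal_le_ofReal (hTψ.abs_snd_le _)
          · simp [hψ0 _ (not_lt.1 hx)]
      _ = ENNReal.ofReal (L / (h - k)) *
            eLpNorm f 1 ((volume.restrict Ω).restrict {x | k < u x}) := by
          rw [lintegral_indicator₀ hA, lintegral_const_mul' _ _ ENNReal.ofReal_ne_top,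
            eLpNorm_one_eq_lintegral_enorm]
      _ ≤ _ := by
          gcongr
          refine (eLpNorm_le_eLpNorm_mul_rpow_measure_univ hp hf.1.restrict).trans ?_
          rw [Measure.restrict_apply_univ, ENNReal.toReal_one, div_one]
          have hexp : 0 ≤ 1 - 1 / p.toReal := by
            rcases eq_or_ne p ⊤ with rfl | hpt
            · simp
            · have : 1 ≤ p.toReal := by
                rw [← ENNReal.toReal_one]; exact ENNReal.toReal_mono hpt hp
              rw [sub_nonneg]
              exact div_le_one_of_le₀ this (by positivity)
          exact mul_le_mul' (eLpNorm_mono_measure f Measure.restrict_le_self)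
            (ENNReal.rpow_le_rpow (Measure.restrict_le_self _) hexp)
  have hen := hu.eLpNorm_truncation_sq_le hN hs hΩ hb hC (hf.integrable hp) hTψ hq
  have hq0' : (0 : ℝ) < q := hq0
  calc volume {x | h < u x} ^ (2 / (q : ℝ))
      ≤ (eLpNorm (T ∘ u) q volume ^ (q : ℝ)) ^ (2 / (q : ℝ)) := by gcongr
    _ = eLpNorm (T ∘ u) q volume ^ 2 := by
        rw [← ENNReal.rpow_mul, mul_div_cancel₀ _ hq0'.ne', ← ENNReal.rpow_natCast]
        norm_num
    _ ≤ (S : ℝ≥0∞) ^ 2 * (ENNReal.ofReal (L / (h - k)) *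
      (eLpNorm f p (volume.restrict Ω) * volume {x | k < u x} ^ (1 - 1 / p.toReal))) := by
        refine hen.trans ?_
        gcongr
    _ = _ := by
        rw [← mul_assoc, mul_div_assoc, ENNReal.ofReal_mul (by positivity),
          ENNReal.ofReal_pow S.coe_nonneg, ENNReal.ofReal_coe_nnreal]

theorem IsWeakSolution.neg {Ω : Set 𝔼} {s : ℝ} {f u : 𝔼 → ℝ} (h : IsWeakSolution Ω s f u) :
    IsWeakSolution Ω s (-f) (-u) := by
  obtain ⟨⟨G, hG, hsol⟩, ⟨G₁, hG₁⟩, h0⟩ := h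
  refine ⟨⟨-G, hG.neg, fun φ hφ => ?_⟩, ⟨-G₁, hG₁.neg⟩, ?_⟩
  · have h1 := hsol φ hφ
    have e1 : ∀ z : 𝔼 × 𝔼, ((-u) z.1 - (-u) z.2) * (φ z.1 - φ z.2) / ‖z.1 - z.2‖ ^ ((N : ℝ) + 2 * s)
        = -((u z.1 - u z.2) * (φ z.1 - φ z.2) / ‖z.1 - z.2‖ ^ ((N : ℝ) + 2 * s)) := fun z => by
      simp only [Pi.neg_apply]; ring
    rw [weakForm] at h1 ⊢
    simp only [e1, integral_neg]
    simp only [Pi.neg_apply, inner_neg_left, integral_neg, neg_mul]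
    rw [← h1]; ring
  · filter_upwards [h0] with x hx hxΩ
    simp [hx hxΩ]

/-- The one-sided bound: the superlevel sets of a weak solution are null above a multiple of the
`L^p` norm of the right-hand side. -/
theorem exists_measure_superlevel_eq_zero (hN : 3 ≤ N) {s : ℝ} (hs : s ∈ Ioo (0 : ℝ) 1)
    {Ω : Set 𝔼} (hΩ : IsOpen Ω) (hb : Bornology.IsBounded Ω) (hC : HasC1Boundary Ω)
    {p : ℝ≥0∞} (hp : (N : ℝ≥0∞) / 2 < p) :
    ∃ C : ℝ, 0 < C ∧ ∀ f u : 𝔼 → ℝ, MemLp f p (volume.restrict Ω) → IsWeakSolution Ω s f u →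
      ∀ K : ℝ, 0 < K → C * (eLpNorm f p (volume.restrict Ω)).toReal ≤ K →
        volume {x | K < u x} = 0 := by
  have hN3 : (3 : ℝ) ≤ N := by exact_mod_cast hN
  have hp1 : 1 ≤ p := by
    refine le_trans ?_ hp.le
    rw [ENNReal.le_div_iff_mul_le (by simp) (by simp), one_mul]
    exact_mod_cast (by omega : 2 ≤ N)
  -- the Sobolev exponent
  set q : ℝ≥0 := Real.toNNReal (2 * N / (N - 2)) with hqdef
  have hqr : 0 < 2 * (N : ℝ) / (N - 2) := div_pos (by linarith) (by linarith)
  have hqc : (q : ℝ) = 2 * N / (N - 2) := Real.coe_toNNReal _ hqr.le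
  have hq0 : 0 < q := by rw [← NNReal.coe_pos, hqc]; exact hqr
  have hq : (q : ℝ)⁻¹ = 2⁻¹ - (N : ℝ)⁻¹ := by
    rw [hqc]
    have : (N : ℝ) ≠ 0 := by linarith
    have : (N : ℝ) - 2 ≠ 0 := by linarith
    field_simp
  have hσ : 2 / (q : ℝ) = 1 - 2 / N := by rw [div_eq_mul_inv, hq]; ring
  -- the exponent condition of Stampacchia's lemma is equivalent to `p > N / 2`
  have hσθ : 2 / (q : ℝ) < 1 - 1 / p.toReal := by
    rw [hσ]
    refine sub_lt_sub_left ?_ 1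
    rcases eq_or_ne p ⊤ with rfl | hpt
    · simp only [ENNReal.toReal_top, div_zero]
      positivity
    · have h1 : (N : ℝ) / 2 < p.toReal := by
        have := (ENNReal.toReal_lt_toReal (ENNReal.div_ne_top (by simp) (by simp)) hpt).2 hp
        simpa using this
      have h2 : 1 / p.toReal < 1 / ((N : ℝ) / 2) :=
        one_div_lt_one_div_of_lt (by positivity) h1
      rwa [one_div_div] at h2
  have hσ0 : 0 < 2 / (q : ℝ) := div_pos two_pos hq0
  obtain ⟨C, hC0, hCl⟩ := exists_measure_superlevel_le hN hs hΩ hb hC hp1 hq0 hq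
  obtain ⟨D, hD0, hD⟩ := exists_stampacchia_level (V := (volume Ω).toReal + 1) hσ0 hσθ
    (by positivity)
  have hΩt : volume Ω ≠ ⊤ := hb.measure_lt_top.ne
  refine ⟨D * (C + 1), by positivity, fun f u hf hu K hK hKf => ?_⟩
  set F : ℝ := (eLpNorm f p (volume.restrict Ω)).toReal with hF
  have hle : ∀ k : ℝ, 0 ≤ k → volume {x | k < u x} ≤ volume Ω := fun k hk => by
    refine measure_mono_ae ?_
    filter_upwards [hu.2.2] with x hx hxk
    by_contra hxΩ
    have hxk' : k < u x := hxk
    rw [hx hxΩ] at hxk'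
    exact hk.not_gt hxk'
  have hfin : ∀ k : ℝ, 0 ≤ k → volume {x | k < u x} ≠ ⊤ := fun k hk =>
    ne_top_of_le_ne_top hΩt (hle k hk)
  -- negative levels, where the measure may be infinite, are moved to `0`
  set a : ℝ → ℝ := fun k => (volume {x | max k 0 < u x}).toReal with ha
  have hak : ∀ k, 0 ≤ k → a k = (volume {x | k < u x}).toReal := fun k hk => by
    simp only [ha, max_eq_left hk]
  have hzero : a K = 0 := by
    refine hD a (C * F) K (fun k h hkh => ?_) (fun k => ENNReal.toReal_nonneg) ?_
      (fun k h hk hkh => ?_) (by positivity) hK ?_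
    · exact ENNReal.toReal_mono (hfin _ (le_max_right _ _))
        (measure_mono fun x hx => lt_of_le_of_lt (max_le_max_right 0 hkh) hx)
    · rw [hak 0 le_rfl]
      have := ENNReal.toReal_mono hΩt (hle 0 le_rfl)
      linarith
    · have h1 := hCl f u hf hu k h hk hkh
      have h2 := ENNReal.toReal_mono (ENNReal.mul_ne_top ENNReal.ofReal_ne_top
        (ENNReal.mul_ne_top hf.2.ne (ENNReal.rpow_ne_top_of_nonneg
          (hσ0.trans hσθ).le (hfin k hk)))) h1
      rw [ENNReal.toReal_mul, ENNReal.toReal_mul, ← ENNReal.toReal_rpow, ← ENNReal.toReal_rpow,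
        ENNReal.toReal_ofReal (div_nonneg hC0 (sub_pos.2 hkh).le), ← hak k hk,
        ← hak h (hk.trans hkh.le)] at h2
      refine h2.trans (le_of_eq ?_)
      ring
    · refine le_trans ?_ hKf
      have hF0 : 0 ≤ F := ENNReal.toReal_nonneg
      nlinarith [mul_nonneg hD0.le hF0]
  rw [hak K hK.le, ENNReal.toReal_eq_zero_iff] at hzero
  exact hzero.resolve_right (hfin K hK.le)

end LevelSets

end MixedLaplacian

theorem theorem3p7 (N : ℕ) [NeZero N] (hN : 3 ≤ N)
    (Ω : Set (EuclideanSpace ℝ (Fin N))) (hΩo : IsOpen Ω) (hΩb : Bornology.IsBounded Ω)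
    (hΩC : MixedLaplacian.HasC1Boundary Ω)
    (s : ℝ) (hs : s ∈ Set.Ioo (0 : ℝ) 1)
    (p : ℝ≥0∞) (hp : (N : ℝ≥0∞) / 2 < p) :
    ∃ C : ℝ, 0 < C ∧
      ∀ f u : EuclideanSpace ℝ (Fin N) → ℝ,
        MemLp f p (volume.restrict Ω) →
        MixedLaplacian.IsWeakSolution Ω s f u →
        MemLp u ∞ volume ∧
          eLpNorm u ∞ volume ≤ ENNReal.ofReal C * eLpNorm f p (volume.restrict Ω) := by
  obtain ⟨C, hC0, hC⟩ := MixedLaplacian.exists_measure_superlevel_eq_zero hN hs hΩo hΩb hΩC hp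
  refine ⟨C, hC0, fun f u hf hu => ?_⟩
  have hbound : eLpNorm u ⊤ volume
      ≤ ENNReal.ofReal C * eLpNorm f p (volume.restrict Ω) := by
    refine ENNReal.le_of_forall_pos_le_add fun ε hε _ => ?_
    set K : ℝ := C * (eLpNorm f p (volume.restrict Ω)).toReal + ε with hK
    have hε' : (0 : ℝ) < ε := hε
    have hK0 : 0 < K := add_pos_of_nonneg_of_pos (by positivity) hε'
    have h1 := hC f u hf hu K hK0 (by linarith)
    have h2 := hC (-f) (-u) hf.neg hu.neg K hK0 (by rw [eLpNorm_neg]; linarith)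
    have hae : ∀ᵐ x, ‖u x‖ ≤ K := by
      filter_upwards [measure_eq_zero_iff_ae_notMem.1 h1, measure_eq_zero_iff_ae_notMem.1 h2]
        with x hx1 hx2
      simp only [not_lt, Pi.neg_apply] at hx1 hx2
      exact abs_le.2 ⟨by linarith, hx1⟩
    rw [eLpNorm_exponent_top]
    refine (eLpNormEssSup_le_of_ae_bound hae).trans (le_of_eq ?_)
    rw [hK, ENNReal.ofReal_add (by positivity) ε.coe_nonneg, ENNReal.ofReal_mul hC0.le,
      ENNReal.ofReal_toReal hf.2.ne, ENNReal.ofReal_coe_nnreal]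
  exact ⟨⟨hu.1.choose_spec.1.memLp.1,
    hbound.trans_lt (ENNReal.mul_lt_top ENNReal.ofReal_lt_top hf.2)⟩, hbound⟩
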